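/- A multigraph with loops consists of a vertex set $V$, a set $\overline{E}$ of directed edges, maps $h,t:\overline{E}\to V$ (head and tail) and an involution $e\mapsto e^{-1}$ of $\overline{E}$ with $h(e^{-1})=t(e)$. A loop is an edge $e$ with $h(e)=t(e)$; it is a half-loop if $e=e^{-1}$ and a whole-loop otherwise. The degree of a vertex $v$ is $|t^{-1}(v)|$. A walk is an edge sequence in which each edge starts where the previous one ends; it is non-backtracking if no edge is followed immediately by its inverse. The girth of a graph is the length of its shortest cycle, where each loop (half-loop or whole-loop) is a cycle of length 1 and two parallel edges form a cycle of length 2; it is $\infty$ if there is no cycle. A graph $G$ is a lift of $H$ if there is a surjective graph homomorphism $\pi:G\to H$ (compatible with heads, tails and inverses) that, for each vertex $v$ of $G$, maps the edges with tail $v$ bijectively onto the edges with tail $\pi(v)$. Let $n(H,g)$ be the smallest number of vertices of a finite lift of $H$ of girth at least $g$. The universal cover $\tilde H$ is the tree whose vertices are the finite non-backtracking walks in $H$ from a fixed vertex, two of them being adjacent if one extends the other by a single step. The non-backtracking matrix $B_H$ of $H$ is the $0$-$1$ matrix indexed by the directed edges with $(B_H)_{f,e}=1$ if and only if $t(f)=h(e)$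 and $e\neq f^{-1}$. **Theorem.** Let $H$ be a finite connected multigraph with loops, with minimum degree at least 2 and maximum degree greater than 2. Then the limit $\rho=\rho(\tilde H)=\lim_{r\to\infty}|B_r(v)|^{1/r}$, where $B_r(v)$ is the ball of radius $r$ around a vertex $v$ of $\tilde H$, exists and depends neither on $v$ nor on the base vertex of $\tilde H$. It equals the Perron eigenvalue of $B_H$, that is, the spectral radius of $B_H$, which is an eigenvalue with a strictly positive eigenvector. For every integer $g\ge 0$ there is a finite lift of $H$ of girth at least $g$, and $$\Omega\big(\rho(\tilde H)^{g/2}\big)\le n(H,g)\le O\big(\rho(\tilde H)^{g}\big),$$ that is, there are constants $c_1,c_2>0$ depending only on $H$ such that $c_1\,\rho^{g/2}\le n(H,g)\le c_2\,\rho^{g}$ for all integers $g\ge 0$. -/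

import Mathlib

open Filter Topology

universe u v w x

/-- An undirected multigraph with loops, given by its directed edges: every directed edge has a tail,
a head and an inverse. A loop `e` is a half-loop if `inv e = e` and a whole-loop otherwise. -/
structure MultiGraph (V : Type u) (E : Type v) where
  head : E → V
  tail : E → V
  inv : E → E
  inv_inv : ∀ e, inv (inv e) = e
  head_inv : ∀ e, head (inv e) = tail e

namespace MultiGraph

variable {V : Type u} {E : Type v} {W : Type w} {F : Type x}

theorem tail_inv (G : MultiGraph V E) (e : E) : G.tail (G.inv e) = G.head e := by
  rw [← G.head_inv, G.inv_inv]

/-- The degree of a vertex: the number of directed edges with that tail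
(a half-loop counts once and a whole-loop counts twice). -/
noncomputable def degree (G : MultiGraph V E) (a : V) : ℕ := (G.tail ⁻¹' {a}).ncard

/-- `G.IsWalk a b p`: the edge sequence `p` is a walk from `a` to `b`. -/
def IsWalk (G : MultiGraph V E) : V → V → List E → Prop
  | a, b, [] => a = b
  | a, b, e :: p => G.tail e = a ∧ G.IsWalk (G.head e) b p

/-- No edge of the sequence is followed immediately by its inverse. -/
def NonBacktracking (G : MultiGraph V E) (p : List E) : Prop :=
  p.IsChain (fun e f => f ≠ G.inv e)

/-- Any two vertices are joined by a walk, and there is at least one vertex. -/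
def Connected (G : MultiGraph V E) : Prop :=
  Nonempty V ∧ ∀ a b, ∃ p, G.IsWalk a b p

/-- The length of a shortest walk (`⊤` if there is no walk). -/
noncomputable def dist (G : MultiGraph V E) (a b : V) : ℕ∞ :=
  ⨅ (p : List E) (_ : G.IsWalk a b p), (p.length : ℕ∞)

/-- The ball of radius `r` centered at a vertex. -/
def ball (G : MultiGraph V E) (a : V) (r : ℕ) : Set V := {b | G.dist a b ≤ r}

/-- A cycle: a nonempty closed non-backtracking walk with pairwise distinct vertices.
A loop of either kind is a cycle of length 1, and two parallel edges form a cycle of length 2. -/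
def IsCycle (G : MultiGraph V E) (p : List E) : Prop :=
  p ≠ [] ∧ (∃ a, G.IsWalk a a p) ∧ G.NonBacktracking p ∧ (p.map G.tail).Nodup

/-- The length of a shortest cycle (`⊤` if there is no cycle). -/
noncomputable def girth (G : MultiGraph V E) : ℕ∞ :=
  ⨅ (p : List E) (_ : G.IsCycle p), (p.length : ℕ∞)

/-- The maps `φ` (on vertices) and `ψ` (on directed edges) form a covering map from `G` to `H`:
a surjective homomorphism that, for every vertex `a` of `G`, is a bijection from the edges
emanating from `a` to the edges emanating from `φ a`. -/
structure IsCovering (G : MultiGraph W F) (H : MultiGraph V E) (φ : W → V) (ψ : F → E) : Prop where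
  head_map : ∀ e, H.head (ψ e) = φ (G.head e)
  tail_map : ∀ e, H.tail (ψ e) = φ (G.tail e)
  inv_map : ∀ e, ψ (G.inv e) = H.inv (ψ e)
  surjective_vertex : Function.Surjective φ
  surjective_edge : Function.Surjective ψ
  bijOn : ∀ a, Set.BijOn ψ (G.tail ⁻¹' {a}) (H.tail ⁻¹' {φ a})

/-- `G` is a lift of `H`. -/
def IsLift (G : MultiGraph W F) (H : MultiGraph V E) : Prop :=
  ∃ (φ : W → V) (ψ : F → E), G.IsCovering H φ ψ

/-- The numbers of vertices of the finite lifts of `H` of girth at least `g`. -/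
def liftSizes (H : MultiGraph V E) (g : ℕ) : Set ℕ :=
  {n | ∃ (W : Type u) (F : Type v) (_ : Finite W) (_ : Finite F) (G : MultiGraph W F),
    G.IsLift H ∧ (g : ℕ∞) ≤ G.girth ∧ Nat.card W = n}

/-- `n(H, g)`: the smallest number of vertices of a lift of `H` of girth at least `g`. -/
noncomputable def minLiftSize (H : MultiGraph V E) (g : ℕ) : ℕ := sInf (H.liftSizes g)

/-- The vertices of the universal cover: the finite non-backtracking walks from a base vertex. -/
def UniversalCoverVertex (H : MultiGraph V E) (a₀ : V) : Type v :=
  {p : List E // (∃ b, H.IsWalk a₀ b p) ∧ H.NonBacktracking p}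

/-- The directed edges of the universal cover: the ordered pairs of non-backtracking walks of which
one extends the other by a single step. -/
def UniversalCoverEdge (H : MultiGraph V E) (a₀ : V) : Type v :=
  {pq : H.UniversalCoverVertex a₀ × H.UniversalCoverVertex a₀ //
    (∃ e, pq.2.1 = pq.1.1 ++ [e]) ∨ (∃ e, pq.1.1 = pq.2.1 ++ [e])}

/-- The universal cover of `H`, built from the base vertex `a₀`. -/
def universalCover (H : MultiGraph V E) (a₀ : V) :
    MultiGraph (H.UniversalCoverVertex a₀) (H.UniversalCoverEdge a₀) where
  tail e := e.1.1
  head e := e.1.2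
  inv e := ⟨(e.1.2, e.1.1), e.2.symm⟩
  inv_inv _ := rfl
  head_inv _ := rfl

/-- `ρ` is the growth rate of the universal cover of `H`: for every vertex `p` of the universal cover
(and every choice of the base vertex), `|B_r(p)| ^ (1 / r)` tends to `ρ` as `r → ∞`. -/
def IsGrowthRate (H : MultiGraph V E) (ρ : ℝ) : Prop :=
  ∀ (a₀ : V) (p : H.UniversalCoverVertex a₀),
    Tendsto (fun r : ℕ => ((((H.universalCover a₀).ball p r).ncard : ℕ) : ℝ) ^ (1 / (r : ℝ)))
      atTop (𝓝 ρ)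

open Classical in
/-- The non-backtracking matrix, indexed by the directed edges. -/
noncomputable def nonBacktrackingMatrix (H : MultiGraph V E) : Matrix E E ℝ :=
  Matrix.of fun f e => if H.tail f = H.head e ∧ e ≠ H.inv f then 1 else 0

end MultiGraph

/-- `ρ` is the Perron eigenvalue of the real square matrix `M`: it is the spectral radius of `M`
(the largest modulus of a complex eigenvalue), and it is an eigenvalue of `M` with
an entrywise positive eigenvector. -/
def IsPerronEigenvalue {n : Type v} [Fintype n] [DecidableEq n] (M : Matrix n n ℝ) (ρ : ℝ) : Prop :=
  spectralRadius ℂ (M.map Complex.ofReal) = ENNReal.ofReal ρ ∧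
    ∃ z : n → ℝ, (∀ i, 0 < z i) ∧ M.mulVec z = ρ • z

/-!
The growth rate, the Moore bound and the Erdős–Sachs bound all come from one count: the number of
non-backtracking walks of length `k` from a vertex of `H` has the order of `ρ ^ k`, where `ρ` is the
Perron eigenvalue of the non-backtracking matrix.

*The count.* A set of edges closed under non-backtracking steps contains two edges with the same head,
because otherwise all degrees would be 2 (`exists_ne_head_eq`). So a walk can turn around, and the
matrix is irreducible (`reflTransGen_follows`). The Collatz–Wielandt argument gives a positive
eigenvector (`Matrix.exists_pos_eigenvector`), which forces its eigenvalue `ρ` to be the spectral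
radius. Inverting the edges makes it a left eigenvector; as a weight on the last edge of a walk it turns
the recursion for the number of walks into `IsGrowthWeight.exists_bounds`, and a vertex of degree at
least 3 gives `1 < ρ`.

*Growth.* A ball of the universal cover around a walk `p` lies between the sets of walks of length
`r - |p|` and of length at most `r + |p|` (`isGrowthRate_of_bounds`).

*Lower bound.* In a graph of girth at least `g`, two non-backtracking walks from `a` of equal length less
than `g / 2` have different ends, since they would otherwise contain a cycle
(`ClosedWalksGE.ncard_nbWalks_le`); and walks of `H` lift to coverings.

*Upper bound.* All lifts considered have vertices `V × X` and edges `E × X`, and differ only in the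
involution of the edges. Suppose that the shortest closed non-backtracking walks have length `γ < g`, and
let `d` be the first edge of one of them. If `X` has more elements than there are non-backtracking walks
of length at most `g + 2`, there is an edge `d'` above the same edge of `H` that is far from `d`.
Exchanging the heads of `d` and `d'` destroys the walk, and every closed non-backtracking walk that uses a
changed edge is longer than `γ` (`ClosedWalksGE.notMem_of_switch`). Hence the number of closed
non-backtracking walks of length `γ` decreases, and repetition makes it zero. Half-loops need no
separate treatment: the first lift is chosen without half-loops, and switching, being a conjugation of
the involution, does not create any.
-/

/-! ### Perron eigenvalues of irreducible nonnegative matrices -/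

section Perron

open Matrix Relation

variable {n : Type v} [Fintype n] {M : Matrix n n ℝ}

theorem Matrix.exists_pow_apply_pos [DecidableEq n] (hM : ∀ i j, 0 ≤ M i j) {i j : n}
    (h : ReflTransGen (fun i j => 0 < M i j) i j) : ∃ k : ℕ, 0 < (M ^ k) i j := by
  induction h with
  | refl => exact ⟨0, by simp⟩
  | @tail b c _ hbc ih =>
    obtain ⟨k, hk⟩ := ih
    refine ⟨k + 1, ?_⟩
    rw [pow_succ, Matrix.mul_apply]
    exact Finset.sum_pos' (fun l _ => mul_nonneg (pow_apply_nonneg hM k i l) (hM l c))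
      ⟨b, Finset.mem_univ b, mul_pos hk hbc⟩

theorem Matrix.exists_sum_pow_apply_pos [DecidableEq n] (hM : ∀ i j, 0 ≤ M i j)
    (hirr : ∀ i j, ReflTransGen (fun i j => 0 < M i j) i j) :
    ∃ m : ℕ, ∀ i j, 0 < (∑ k ∈ Finset.range m, M ^ k) i j := by
  choose k hk using fun p : n × n => exists_pow_apply_pos hM (hirr p.1 p.2)
  refine ⟨Finset.univ.sup k + 1, fun i j => ?_⟩
  rw [Matrix.sum_apply]
  exact Finset.sum_pos' (fun l _ => pow_apply_nonneg hM l i j)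
    ⟨k (i, j), Finset.mem_range_succ_iff.2 (Finset.le_sup (Finset.mem_univ (i, j))), hk (i, j)⟩

theorem Matrix.mulVec_pos_of_pos {P : Matrix n n ℝ} (hP : ∀ i j, 0 < P i j) {y : n → ℝ}
    (hy : ∀ i, 0 ≤ y i) {i₀ : n} (hi₀ : 0 < y i₀) (i : n) : 0 < (P *ᵥ y) i :=
  Finset.sum_pos' (fun j _ => mul_nonneg (hP i j).le (hy j))
    ⟨i₀, Finset.mem_univ _, mul_pos (hP i i₀) hi₀⟩

/-- The numbers `r` occurring in the Collatz–Wielandt maximization are bounded. -/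
theorem Matrix.le_sum_of_smul_le_mulVec (hM : ∀ i j, 0 ≤ M i j) {r : ℝ} {y : n → ℝ}
    (hy : y ∈ stdSimplex ℝ n) (h : ∀ i, r * y i ≤ (M *ᵥ y) i) : r ≤ ∑ i, ∑ j, M i j := by
  calc r = ∑ i, r * y i := by rw [← Finset.mul_sum, hy.2, mul_one]
    _ ≤ ∑ i, (M *ᵥ y) i := Finset.sum_le_sum fun i _ => h i
    _ ≤ ∑ i, ∑ j, M i j := by
      refine Finset.sum_le_sum fun i _ => Finset.sum_le_sum fun j _ => ?_
      refine mul_le_of_le_one_right (hM i j) ?_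
      rw [← hy.2]
      exact Finset.single_le_sum (fun l _ => hy.1 l) (Finset.mem_univ j)

/-- An irreducible nonnegative matrix has an entrywise positive eigenvector. The eigenvalue is the
Collatz–Wielandt maximum: the largest `r` with `r • y ≤ M y` for some `y` in the simplex. If a
maximizer `y` were not an eigenvector, the positive matrix `∑ k < m, M ^ k`, which commutes with `M`,
would turn `r • y ≤ M y` into a strict inequality in every coordinate. -/
theorem Matrix.exists_pos_eigenvector [DecidableEq n] [Nonempty n] (hM : ∀ i j, 0 ≤ M i j)
    (hirr : ∀ i j, ReflTransGen (fun i j => 0 < M i j) i j) :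
    ∃ ρ : ℝ, 0 ≤ ρ ∧ ∃ z : n → ℝ, (∀ i, 0 < z i) ∧ M *ᵥ z = ρ • z := by
  obtain ⟨m, hm⟩ := exists_sum_pow_apply_pos hM hirr
  set P := ∑ k ∈ Finset.range m, M ^ k with hP
  have hcomm : M * P = P * M := by
    simp only [hP, Finset.mul_sum, Finset.sum_mul, ← pow_succ, ← pow_succ']
  let S : Set (ℝ × (n → ℝ)) :=
    (Set.Icc 0 (∑ i, ∑ j, M i j) ×ˢ stdSimplex ℝ n) ∩ {q | ∀ i, q.1 * q.2 i ≤ (M *ᵥ q.2) i}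
  have hScomp : IsCompact S := by
    refine (isCompact_Icc.prod (isCompact_stdSimplex ℝ n)).inter_right ?_
    simp only [Set.ofPred_forall]
    refine isClosed_iInter fun i => isClosed_le (by fun_prop) ?_
    simp only [mulVec, dotProduct]
    fun_prop
  have hSne : S.Nonempty := by
    obtain ⟨i⟩ := ‹Nonempty n›
    refine ⟨(0, Pi.single i 1), ⟨⟨le_rfl, Finset.sum_nonneg fun i _ => Finset.sum_nonneg
      fun j _ => hM i j⟩, single_mem_stdSimplex ℝ i⟩, fun l => ?_⟩
    simpa using hM l i
  obtain ⟨⟨r, y⟩, ⟨⟨⟨hr0, -⟩, hy⟩, hry⟩, hmax⟩ :=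
    hScomp.exists_isMaxOn hSne continuous_fst.continuousOn
  dsimp only at hr0 hy hry
  have hpos : ∃ i, 0 < y i := by
    by_contra! h
    have := Finset.sum_nonpos fun i (_ : i ∈ Finset.univ) => h i
    rw [hy.2] at this
    linarith
  obtain ⟨i₀, hi₀⟩ := hpos
  have hPy : ∀ i, 0 < (P *ᵥ y) i := mulVec_pos_of_pos hm hy.1 hi₀
  have key : M *ᵥ y = r • y := by
    by_contra hne
    obtain ⟨i₁, hi₁⟩ : ∃ i, 0 < (M *ᵥ y - r • y) i := by
      by_contra! h
      exact hne (funext fun i => le_antisymm (by simpa using h i) (hry i))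
    have hgap : ∀ i, 0 < (P *ᵥ (M *ᵥ y - r • y)) i :=
      mulVec_pos_of_pos hm (fun i => by simpa using hry i) hi₁
    have hgap' : ∀ i, r * (P *ᵥ y) i < (M *ᵥ (P *ᵥ y)) i := by
      intro i
      have := hgap i
      rw [mulVec_sub, mulVec_mulVec, ← hcomm, ← mulVec_mulVec, mulVec_smul] at this
      simpa using this
    obtain ⟨i₂, hi₂⟩ := Finite.exists_min
      fun i => ((M *ᵥ (P *ᵥ y)) i - r * (P *ᵥ y) i) / (P *ᵥ y) i
    set ε := ((M *ᵥ (P *ᵥ y)) i₂ - r * (P *ᵥ y) i₂) / (P *ᵥ y) i₂ with hε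
    have hεpos : 0 < ε := div_pos (sub_pos.2 (hgap' i₂)) (hPy i₂)
    have hle : ∀ i, (r + ε) * (P *ᵥ y) i ≤ (M *ᵥ (P *ᵥ y)) i := by
      intro i
      have := (le_div_iff₀ (hPy i)).1 (hi₂ i)
      linarith
    set s := ∑ i, (P *ᵥ y) i with hs
    have hspos : 0 < s := Finset.sum_pos (fun i _ => hPy i) Finset.univ_nonempty
    have hmem : s⁻¹ • (P *ᵥ y) ∈ stdSimplex ℝ n := by
      refine ⟨fun i => mul_nonneg (inv_nonneg.2 hspos.le) (hPy i).le, ?_⟩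
      simp only [Pi.smul_apply, smul_eq_mul, ← Finset.mul_sum]
      exact inv_mul_cancel₀ hspos.ne'
    have hle' : ∀ i, (r + ε) * (s⁻¹ • (P *ᵥ y)) i ≤ (M *ᵥ (s⁻¹ • (P *ᵥ y))) i := by
      intro i
      rw [mulVec_smul]
      simp only [Pi.smul_apply, smul_eq_mul]
      calc (r + ε) * (s⁻¹ * (P *ᵥ y) i) = s⁻¹ * ((r + ε) * (P *ᵥ y) i) := by ring
        _ ≤ _ := mul_le_mul_of_nonneg_left (hle i) (inv_nonneg.2 hspos.le)
    have := hmax (show (r + ε, s⁻¹ • (P *ᵥ y)) ∈ S from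
      ⟨⟨⟨by positivity, le_sum_of_smul_le_mulVec hM hmem hle'⟩, hmem⟩, hle'⟩)
    simp only [Set.mem_ofPred_eq] at this
    linarith
  refine ⟨r, hr0, P *ᵥ y, hPy, ?_⟩
  rw [mulVec_mulVec, hcomm, ← mulVec_mulVec, key, mulVec_smul]

/-- A positive eigenvector `z` of a nonnegative matrix bounds all eigenvalues: evaluate the eigenvalue
equation of `v` at a coordinate where `‖v i‖ / z i` is largest. -/
theorem Matrix.isPerronEigenvalue_of_pos_eigenvector [DecidableEq n] [Nonempty n]
    (hM : ∀ i j, 0 ≤ M i j) {ρ : ℝ} (hρ : 0 ≤ ρ) {z : n → ℝ} (hz : ∀ i, 0 < z i) (h : M *ᵥ z = ρ • z) :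
    IsPerronEigenvalue M ρ := by
  refine ⟨le_antisymm (iSup₂_le fun k hk => ?_) ?_, z, hz, h⟩
  · rw [← Matrix.spectrum_toLin', ← Module.End.hasEigenvalue_iff_mem_spectrum] at hk
    obtain ⟨v, hv⟩ := hk.exists_hasEigenvector
    have hMv : (M.map Complex.ofReal) *ᵥ v = k • v := by simpa using hv.apply_eq_smul
    obtain ⟨i, hi⟩ := Finite.exists_max fun i => ‖v i‖ / z i
    set t := ‖v i‖ / z i with ht
    have hle : ∀ j, ‖v j‖ ≤ t * z j := fun j => (div_le_iff₀ (hz j)).1 (hi j)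
    have heq : ‖v i‖ = t * z i := (div_mul_cancel₀ _ (hz i).ne').symm
    have htpos : 0 < t := by
      obtain ⟨j, hj⟩ := Function.ne_iff.1 hv.2
      exact (div_pos (norm_pos_iff.2 hj) (hz j)).trans_le (hi j)
    have hnorm : ‖k‖ * ‖v i‖ ≤ ρ * ‖v i‖ := by
      calc ‖k‖ * ‖v i‖ = ‖((M.map Complex.ofReal) *ᵥ v) i‖ := by
            rw [hMv, Pi.smul_apply, smul_eq_mul, norm_mul]
        _ ≤ ∑ j, ‖(M.map Complex.ofReal) i j * v j‖ := norm_sum_le _ _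
        _ ≤ ∑ j, t * (M i j * z j) := by
            refine Finset.sum_le_sum fun j _ => ?_
            rw [norm_mul, Matrix.map_apply, Complex.norm_real, Real.norm_of_nonneg (hM i j)]
            calc M i j * ‖v j‖ ≤ M i j * (t * z j) := mul_le_mul_of_nonneg_left (hle j) (hM i j)
              _ = _ := by ring
        _ = t * (M *ᵥ z) i := by rw [← Finset.mul_sum]; rfl
        _ = ρ * ‖v i‖ := by rw [h, heq, Pi.smul_apply, smul_eq_mul]; ring
    have hk' : ‖k‖ ≤ ρ :=
      le_of_mul_le_mul_right hnorm (heq ▸ mul_pos htpos (hz i))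
    rw [← ENNReal.ofReal_coe_nnreal, coe_nnnorm]
    exact ENNReal.ofReal_le_ofReal hk'
  · have hmem : (ρ : ℂ) ∈ spectrum ℂ (M.map Complex.ofReal) := by
      rw [← Matrix.spectrum_toLin', ← Module.End.hasEigenvalue_iff_mem_spectrum]
      refine Module.End.hasEigenvalue_of_hasEigenvector (x := fun i => (z i : ℂ)) ⟨?_, ?_⟩
      · rw [Module.End.mem_eigenspace_iff, Matrix.toLin'_apply]
        ext i
        have := congrFun h i
        simp only [mulVec, dotProduct, Pi.smul_apply, smul_eq_mul, Matrix.map_apply] at this ⊢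
        exact_mod_cast this
      · obtain ⟨i⟩ := ‹Nonempty n›
        exact Function.ne_iff.2 ⟨i, by simpa using (hz i).ne'⟩
    refine le_trans ?_ (le_iSup₂ (f := fun k (_ : k ∈ spectrum ℂ (M.map Complex.ofReal)) =>
      (‖k‖₊ : ENNReal)) (ρ : ℂ) hmem)
    rw [← ENNReal.ofReal_coe_nnreal, coe_nnnorm, Complex.norm_real, Real.norm_of_nonneg hρ]

end Perron

namespace MultiGraph

variable {V : Type u} {E : Type v} {W : Type w} {F : Type x}

/-! ### Walks -/

theorem inv_injective (G : MultiGraph V E) : Function.Injective G.inv :=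
  Function.LeftInverse.injective G.inv_inv

theorem inv_eq_iff (G : MultiGraph V E) {e f : E} : G.inv e = f ↔ e = G.inv f :=
  ⟨fun h => by rw [← h, G.inv_inv], fun h => by rw [h, G.inv_inv]⟩

theorem isWalk_append (G : MultiGraph V E) {a c : V} {p q : List E} :
    G.IsWalk a c (p ++ q) ↔ ∃ b, G.IsWalk a b p ∧ G.IsWalk b c q := by
  induction p generalizing a with
  | nil => simp [IsWalk]
  | cons e p ih => simp [IsWalk, ih, and_assoc]

theorem IsWalk.append {G : MultiGraph V E} {a b c : V} {p q : List E} (hp : G.IsWalk a b p)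
    (hq : G.IsWalk b c q) : G.IsWalk a c (p ++ q) :=
  G.isWalk_append.2 ⟨b, hp, hq⟩

theorem IsWalk.end_unique {G : MultiGraph V E} {a b c : V} {p : List E} (hb : G.IsWalk a b p)
    (hc : G.IsWalk a c p) : b = c := by
  induction p generalizing a with
  | nil => exact hb.symm.trans hc
  | cons e p ih => exact ih hb.2 hc.2

theorem isWalk_singleton (G : MultiGraph V E) (e : E) : G.IsWalk (G.tail e) (G.head e) [e] :=
  ⟨rfl, rfl⟩

/-- The walk `p` traversed backwards. -/
def reverse (G : MultiGraph V E) (p : List E) : List E := (p.map G.inv).reverse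

@[simp]
theorem length_reverse (G : MultiGraph V E) (p : List E) : (G.reverse p).length = p.length := by
  simp [reverse]

theorem IsWalk.reverse {G : MultiGraph V E} {a b : V} {p : List E} (hp : G.IsWalk a b p) :
    G.IsWalk b a (G.reverse p) := by
  induction p generalizing a with
  | nil => exact hp.symm
  | cons e p ih =>
    have := (ih hp.2).append (q := [G.inv e]) ⟨G.tail_inv e, (G.head_inv e).trans hp.1⟩
    simpa [MultiGraph.reverse] using this

theorem NonBacktracking.reverse {G : MultiGraph V E} {p : List E} (hp : G.NonBacktracking p) :
    G.NonBacktracking (G.reverse p) := by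
  unfold NonBacktracking MultiGraph.reverse
  rw [List.isChain_reverse, List.isChain_map]
  refine hp.imp fun e f hef h => hef ?_
  simpa [G.inv_inv] using h.symm

/-- The edge `f` may follow the edge `e` in a non-backtracking walk. -/
def Follows (G : MultiGraph V E) (e f : E) : Prop := G.tail f = G.head e ∧ f ≠ G.inv e

theorem follows_inv_inv (G : MultiGraph V E) {e f : E} :
    G.Follows (G.inv f) (G.inv e) ↔ G.Follows e f := by
  unfold Follows
  rw [G.tail_inv, G.head_inv, G.inv_inv]
  exact ⟨fun h => ⟨h.1.symm, fun h' => h.2 h'.symm⟩, fun h => ⟨h.1.symm, fun h' => h.2 h'.symm⟩⟩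

/-! ### Irreducibility of the non-backtracking matrix -/

section Irreducible

open Relation

variable {H : MultiGraph V E}

theorem exists_follows (hmin : ∀ a, 2 ≤ H.degree a) (e : E) : ∃ f, H.Follows e f := by
  obtain ⟨f, hf, hne⟩ := Set.exists_ne_of_one_lt_ncard (hmin (H.head e)) (H.inv e)
  exact ⟨f, hf, hne⟩

/-- A nonempty set `C` of edges that is closed under non-backtracking steps contains two edges with
the same head. Otherwise every edge of `C` has a unique successor, the successor map permutes `C`,
and the heads of `C` form a set of vertices of degree at most 2 that is closed under adjacency. -/
theorem exists_ne_head_eq [Finite E] (hconn : H.Connected) (hmin : ∀ a, 2 ≤ H.degree a)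
    (hmax : ∃ a, 2 < H.degree a) {C : Set E} (hne : C.Nonempty)
    (hC : ∀ e ∈ C, ∀ f, H.Follows e f → f ∈ C) :
    ∃ e ∈ C, ∃ f ∈ C, e ≠ f ∧ H.head e = H.head f := by
  by_contra! hinj
  have hinj' : ∀ e ∈ C, ∀ f ∈ C, H.head e = H.head f → e = f := fun e he f hf h => by
    by_contra hef
    exact hinj e he f hf hef h
  choose s hs using exists_follows hmin
  have hmaps : Set.MapsTo s C C := fun e he => hC e he _ (hs e)
  have hsurj : Set.SurjOn s C C := by
    have hinjOn : Set.InjOn s C := fun e he f hf hef =>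
      hinj' e he f hf (by rw [← (hs e).1, ← (hs f).1, hef])
    exact (Set.eq_of_subset_of_ncard_le hmaps.image_subset
      hinjOn.ncard_image.ge (Set.toFinite _)).ge
  have huniq : ∀ e ∈ C, ∀ f, H.tail f = H.head e → f = s e ∨ f = H.inv e := by
    intro e he f hf
    by_cases hfe : f = H.inv e
    · exact Or.inr hfe
    · obtain ⟨e', he', rfl⟩ := hsurj (hC e he f ⟨hf, hfe⟩)
      rw [hinj' e' he' e he ((hs e').1.symm.trans hf)]
      exact Or.inl rfl
  have hwalk : ∀ p a b, a ∈ H.head '' C → H.IsWalk a b p → b ∈ H.head '' C := by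
    intro p
    induction p with
    | nil => rintro a b ha rfl; exact ha
    | cons f p ih =>
      rintro _ b ⟨e, he, rfl⟩ ⟨hf, hp⟩
      refine ih _ b ?_ hp
      rcases huniq e he f hf with rfl | rfl
      · exact ⟨s e, hmaps he, rfl⟩
      · obtain ⟨e', he', rfl⟩ := hsurj he
        exact ⟨e', he', by rw [H.head_inv, (hs e').1]⟩
  obtain ⟨e₀, he₀⟩ := hne
  obtain ⟨a, ha⟩ := hmax
  obtain ⟨p, hp⟩ := hconn.2 (H.head e₀) a
  obtain ⟨e, he, rfl⟩ := hwalk p _ a ⟨e₀, he₀, rfl⟩ hp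
  have hsub : H.tail ⁻¹' {H.head e} ⊆ {s e, H.inv e} := fun f hf => huniq e he f hf
  have := (Set.ncard_le_ncard hsub (Set.toFinite _)).trans (Set.ncard_insert_le _ _)
  rw [Set.ncard_singleton] at this
  exact absurd ha (not_lt.2 this)

theorem reflTransGen_follows_inv [Finite E] (hconn : H.Connected) (hmin : ∀ a, 2 ≤ H.degree a)
    (hmax : ∃ a, 2 < H.degree a) (e : E) : ReflTransGen H.Follows e (H.inv e) := by
  obtain ⟨f, hf, g, hg, hfg, hhead⟩ := exists_ne_head_eq hconn hmin hmax
    (C := {f | ReflTransGen H.Follows e f}) ⟨e, ReflTransGen.refl⟩ fun f hf g hfg => hf.tail hfg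
  -- The walk goes from `e` to `g`, turns back along `f`, and returns along the inverse of the
  -- walk from `e` to `f`.
  have hturn : H.Follows g (H.inv f) :=
    ⟨by rw [H.tail_inv, hhead], fun h => hfg (H.inv_injective h)⟩
  refine ReflTransGen.trans (ReflTransGen.tail hg hturn) ?_
  have hswap : ReflTransGen (Function.swap H.Follows) f e := reflTransGen_swap.2 hf
  exact ReflTransGen.lift (r := Function.swap H.Follows) H.inv
    (fun a b hab => H.follows_inv_inv.2 hab) _ _ hswap

/-- Any edge leads to any other edge by a non-backtracking walk. -/
theorem reflTransGen_follows [Finite E] (hconn : H.Connected) (hmin : ∀ a, 2 ≤ H.degree a)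
    (hmax : ∃ a, 2 < H.degree a) (e f : E) : ReflTransGen H.Follows e f := by
  have hinv := reflTransGen_follows_inv hconn hmin hmax
  have hstep : ∀ g h, H.tail h = H.head g → ReflTransGen H.Follows g h := by
    intro g h hgh
    by_cases hne : h = H.inv g
    · exact hne ▸ hinv g
    · exact ReflTransGen.single ⟨hgh, hne⟩
  obtain ⟨p, hp⟩ := hconn.2 (H.head e) (H.tail f)
  have hwalk : ∀ p g, H.IsWalk (H.head g) (H.tail f) p → ReflTransGen H.Follows g f := by
    intro p
    induction p with
    | nil => intro g hg; exact hstep g f hg.symm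
    | cons h p ih => intro g hg; exact (hstep g h hg.1).trans (ih h hg.2)
  exact hwalk p e hp

end Irreducible

/-! ### The Perron eigenvalue of the non-backtracking matrix -/

section Perron

variable {H : MultiGraph V E}

open Classical in
/-- Positive edge weights that are multiplied by `ρ` when they are summed over the successors of an
edge: they are the left Perron eigenvector of the non-backtracking matrix. -/
structure IsGrowthWeight [Fintype E] (H : MultiGraph V E) (ρ : ℝ) (y : E → ℝ) : Prop where
  pos : ∀ e, 0 < y e
  sum_eq : ∀ e, ∑ f with H.Follows e f, y f = ρ * y e

theorem nonBacktrackingMatrix_nonneg (f e : E) : 0 ≤ H.nonBacktrackingMatrix f e := by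
  unfold nonBacktrackingMatrix
  rw [Matrix.of_apply]
  split_ifs <;> simp

open Classical in
theorem nonBacktrackingMatrix_apply (f e : E) :
    H.nonBacktrackingMatrix f e = if H.Follows e f then 1 else 0 := by
  unfold nonBacktrackingMatrix Follows
  rw [Matrix.of_apply]
  congr 1
  rw [ne_eq, ne_eq, eq_comm (a := e), H.inv_eq_iff]

variable [Fintype E]

/-- Inversion of the edges turns a right eigenvector of the non-backtracking matrix into a left
eigenvector. -/
theorem IsGrowthWeight.of_mulVec {ρ : ℝ} {z : E → ℝ} (hz : ∀ e, 0 < z e)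
    (h : H.nonBacktrackingMatrix.mulVec z = ρ • z) :
    H.IsGrowthWeight ρ (fun e => z (H.inv e)) := by
  classical
  refine ⟨fun e => hz _, fun e => ?_⟩
  have h' := congrFun h (H.inv e)
  rw [Pi.smul_apply, smul_eq_mul] at h'
  rw [← h', Matrix.mulVec, dotProduct, Finset.sum_filter]
  refine Fintype.sum_equiv (Function.Involutive.toPerm H.inv H.inv_inv) _ _ fun f => ?_
  change _ = H.nonBacktrackingMatrix (H.inv e) (H.inv f) * z (H.inv f)
  simp only [nonBacktrackingMatrix_apply, H.follows_inv_inv, ite_mul, one_mul, zero_mul]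

/-- At an edge of minimal weight the sum over the successors is at least the weight itself, with
equality only if there is a single successor, again of minimal weight. By irreducibility, `ρ ≤ 1`
would force all edges to have a single successor. -/
theorem IsGrowthWeight.one_lt {ρ : ℝ} {y : E → ℝ} (hy : H.IsGrowthWeight ρ y)
    (hconn : H.Connected) (hmin : ∀ a, 2 ≤ H.degree a) (hmax : ∃ a, 2 < H.degree a) : 1 < ρ := by
  classical
  by_contra! hρ
  obtain ⟨a, ha⟩ := hmax
  have hEne : Nonempty E := by
    obtain ⟨e, -⟩ := Set.nonempty_of_ncard_ne_zero (s := H.tail ⁻¹' {a}) (by unfold degree at ha; omega)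
    exact ⟨e⟩
  obtain ⟨e₀, he₀⟩ := Finite.exists_min y
  have hle : ∀ e, y e = y e₀ → ∀ f, H.Follows e f → y f = y e₀ ∧ ∀ g, H.Follows e g → g = f := by
    intro e he f hf
    have hsum := hy.sum_eq e
    have hfmem : f ∈ Finset.univ.filter (H.Follows e) := by simpa using hf
    rw [← Finset.add_sum_erase _ _ hfmem] at hsum
    have hub : ρ * y e ≤ y e₀ := by
      rw [he]
      exact mul_le_of_le_one_left (hy.pos _).le hρ
    have hnonneg : 0 ≤ ∑ g ∈ (Finset.univ.filter (H.Follows e)).erase f, y g :=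
      Finset.sum_nonneg fun g _ => (hy.pos g).le
    refine ⟨le_antisymm (by linarith) (he₀ f), fun g hg => ?_⟩
    by_contra hgf
    have hgmem : g ∈ (Finset.univ.filter (H.Follows e)).erase f := by simpa [hgf] using hg
    have := Finset.single_le_sum (fun g _ => (hy.pos g).le) hgmem
    linarith [he₀ f, hy.pos g]
  have hall : ∀ e, y e = y e₀ := by
    intro e
    induction reflTransGen_follows hconn hmin ⟨a, ha⟩ e₀ e with
    | refl => rfl
    | tail _ hfg ih => exact (hle _ ih _ hfg).1
  obtain ⟨e, he⟩ : ∃ e, H.head e = a := by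
    obtain ⟨f, hf⟩ := Set.nonempty_of_ncard_ne_zero (s := H.tail ⁻¹' {a})
      (by unfold degree at ha; omega)
    exact ⟨H.inv f, (H.head_inv f).trans hf⟩
  obtain ⟨f, hf⟩ := exists_follows hmin e
  have hsub : H.tail ⁻¹' {a} ⊆ {f, H.inv e} := by
    intro g hg
    by_cases hge : g = H.inv e
    · exact Or.inr hge
    · exact Or.inl ((hle e (hall e) f hf).2 g ⟨hg.trans he.symm, hge⟩)
  have := (Set.ncard_le_ncard hsub (Set.toFinite _)).trans (Set.ncard_insert_le _ _)
  rw [Set.ncard_singleton] at this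
  exact absurd ha (not_lt.2 this)

theorem exists_isPerronEigenvalue [DecidableEq E] (hconn : H.Connected)
    (hmin : ∀ a, 2 ≤ H.degree a) (hmax : ∃ a, 2 < H.degree a) :
    ∃ ρ : ℝ, IsPerronEigenvalue H.nonBacktrackingMatrix ρ ∧ 1 < ρ ∧ ∃ y, H.IsGrowthWeight ρ y := by
  have hEne : Nonempty E := by
    obtain ⟨a, ha⟩ := hmax
    obtain ⟨e, -⟩ := Set.nonempty_of_ncard_ne_zero (s := H.tail ⁻¹' {a})
      (by unfold degree at ha; omega)
    exact ⟨e⟩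
  obtain ⟨ρ, hρ, z, hz, h⟩ := Matrix.exists_pos_eigenvector
    (M := H.nonBacktrackingMatrix) nonBacktrackingMatrix_nonneg (by
      classical
      intro i j
      rw [← Relation.reflTransGen_swap]
      refine Relation.ReflTransGen.mono (r := H.Follows) (fun e f hef => ?_) _ _
        (reflTransGen_follows hconn hmin hmax j i)
      have hef' : H.Follows e f := hef
      simp [Function.swap, nonBacktrackingMatrix_apply, hef'])
  have hy := IsGrowthWeight.of_mulVec hz h
  exact ⟨ρ, Matrix.isPerronEigenvalue_of_pos_eigenvector nonBacktrackingMatrix_nonneg hρ hz h,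
    hy.one_lt hconn hmin hmax, _, hy⟩

end Perron

/-! ### Counting non-backtracking walks -/

/-- The non-backtracking walks of length `k` that start at the vertex `a`. -/
def nbWalks (G : MultiGraph V E) (a : V) (k : ℕ) : Set (List E) :=
  {p | (∃ b, G.IsWalk a b p) ∧ G.NonBacktracking p ∧ p.length = k}

/-- The walks of length `k` that continue the edge `e` to a non-backtracking walk. -/
def nbTails (G : MultiGraph V E) (e : E) (k : ℕ) : Set (List E) :=
  {p | (∃ b, G.IsWalk (G.head e) b p) ∧ G.NonBacktracking (e :: p) ∧ p.length = k}

theorem nbWalks_zero (G : MultiGraph V E) (a : V) : G.nbWalks a 0 = {[]} := by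
  ext p
  constructor
  · exact fun h => List.length_eq_zero_iff.1 h.2.2
  · rintro rfl
    exact ⟨⟨a, rfl⟩, List.IsChain.nil, rfl⟩

theorem nbTails_zero (G : MultiGraph V E) (e : E) : G.nbTails e 0 = {[]} := by
  ext p
  constructor
  · exact fun h => List.length_eq_zero_iff.1 h.2.2
  · rintro rfl
    exact ⟨⟨_, rfl⟩, List.IsChain.singleton e, rfl⟩

/-- The non-backtracking walks of length at most `r` that start at the vertex `a`. -/
def nbWalksLE (G : MultiGraph V E) (a : V) (r : ℕ) : Set (List E) :=
  {p | (∃ b, G.IsWalk a b p) ∧ G.NonBacktracking p ∧ p.length ≤ r}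

section Counting

variable {H : MultiGraph V E}

theorem finite_nbWalks [Finite E] (H : MultiGraph V E) (a : V) (k : ℕ) : (H.nbWalks a k).Finite :=
  (List.finite_length_eq E k).subset fun _ h => h.2.2

theorem finite_nbTails [Finite E] (H : MultiGraph V E) (e : E) (k : ℕ) : (H.nbTails e k).Finite :=
  (List.finite_length_eq E k).subset fun _ h => h.2.2

theorem finite_nbWalksLE [Finite E] (H : MultiGraph V E) (a : V) (r : ℕ) :
    (H.nbWalksLE a r).Finite :=
  (List.finite_length_le E r).subset fun _ h => h.2.2

theorem ncard_nbWalksLE_le [Finite E] (H : MultiGraph V E) (a : V) (r : ℕ) :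
    (H.nbWalksLE a r).ncard ≤ ∑ k ∈ Finset.range (r + 1), (H.nbWalks a k).ncard := by
  classical
  have hsub : H.nbWalksLE a r ⊆
      ((Finset.range (r + 1)).biUnion fun k => (H.finite_nbWalks a k).toFinset : Finset (List E)) := by
    intro p hp
    simp only [Finset.coe_biUnion, Set.mem_iUnion, Finset.coe_range, Set.Finite.coe_toFinset]
    exact ⟨p.length, Nat.lt_succ_of_le hp.2.2, hp.1, hp.2.1, rfl⟩
  refine (Set.ncard_le_ncard hsub (Finset.finite_toSet _)).trans ?_
  rw [Set.ncard_coe_finset]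
  refine Finset.card_biUnion_le.trans (Finset.sum_le_sum fun k _ => ?_)
  rw [Set.ncard_eq_toFinset_card _ (H.finite_nbWalks a k)]

theorem ncard_biUnion_cons (s : Finset E) {T : E → Set (List E)} (hT : ∀ f, (T f).Finite) :
    (⋃ f ∈ s, List.cons f '' T f).ncard = ∑ f ∈ s, (T f).ncard := by
  classical
  have : (⋃ f ∈ s, List.cons f '' T f) =
      (s.biUnion fun f => (hT f).toFinset.image (List.cons f) : Finset (List E)) := by
    ext p
    simp
  rw [this, Set.ncard_coe_finset, Finset.card_biUnion]
  · refine Finset.sum_congr rfl fun f _ => ?_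
    rw [Finset.card_image_of_injective _ (List.cons_injective), Set.ncard_eq_toFinset_card _ (hT f)]
  · intro f _ g _ hfg
    rw [Function.onFun, Finset.disjoint_left]
    rintro p hp hq
    obtain ⟨q, -, rfl⟩ := Finset.mem_image.1 hp
    obtain ⟨q', -, h⟩ := Finset.mem_image.1 hq
    exact hfg (List.cons.inj h).1.symm

variable [Fintype E]

open Classical in
theorem ncard_nbTails_succ (e : E) (k : ℕ) :
    (H.nbTails e (k + 1)).ncard = ∑ f with H.Follows e f, (H.nbTails f k).ncard := by
  rw [← ncard_biUnion_cons _ fun f => H.finite_nbTails f k]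
  congr 1
  ext p
  cases p with
  | nil => simp [nbTails]
  | cons f p =>
    simp only [Finset.mem_filter_univ, nbTails, NonBacktracking, IsWalk, Set.mem_ofPred_eq,
      List.isChain_cons_cons, List.length_cons, Nat.add_right_cancel_iff, Set.mem_iUnion, Set.mem_image, List.cons.injEq, exists_prop]
    constructor
    · rintro ⟨⟨b, h1, h2⟩, ⟨h3, h4⟩, h5⟩
      exact ⟨f, ⟨h1, h3⟩, p, ⟨⟨b, h2⟩, h4, h5⟩, rfl, rfl⟩
    · rintro ⟨_, ⟨h1, h3⟩, _, ⟨⟨b, h2⟩, h4, h5⟩, rfl, rfl⟩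
      exact ⟨⟨b, h1, h2⟩, ⟨h3, h4⟩, h5⟩

open Classical in
theorem ncard_nbWalks_succ (a : V) (k : ℕ) :
    (H.nbWalks a (k + 1)).ncard = ∑ f with H.tail f = a, (H.nbTails f k).ncard := by
  rw [← ncard_biUnion_cons _ fun f => H.finite_nbTails f k]
  congr 1
  ext p
  cases p with
  | nil => simp [nbWalks]
  | cons f p =>
    simp only [nbWalks, nbTails, IsWalk, Set.mem_ofPred_eq,
      List.length_cons, Nat.add_right_cancel_iff, Finset.mem_filter,
      Finset.mem_univ, true_and, Set.mem_iUnion, Set.mem_image, List.cons.injEq, exists_prop]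
    constructor
    · rintro ⟨⟨b, h1, h2⟩, h4, h5⟩
      exact ⟨f, h1, p, ⟨⟨b, h2⟩, h4, h5⟩, rfl, rfl⟩
    · rintro ⟨_, h1, _, ⟨⟨b, h2⟩, h4, h5⟩, rfl, rfl⟩
      exact ⟨⟨b, h1, h2⟩, h4, h5⟩

theorem IsGrowthWeight.mul_ncard_nbTails_le {ρ : ℝ} {y : E → ℝ} (hy : H.IsGrowthWeight ρ y)
    {m : ℝ} (hm : ∀ e, m ≤ y e) (e : E) (k : ℕ) :
    m * (H.nbTails e k).ncard ≤ ρ ^ k * y e := by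
  classical
  induction k generalizing e with
  | zero => simpa [nbTails_zero] using hm e
  | succ k ih =>
    rw [ncard_nbTails_succ, Nat.cast_sum, Finset.mul_sum, pow_succ, mul_assoc, ← hy.sum_eq e,
      Finset.mul_sum]
    exact Finset.sum_le_sum fun f _ => ih f

theorem IsGrowthWeight.le_mul_ncard_nbTails {ρ : ℝ} {y : E → ℝ} (hy : H.IsGrowthWeight ρ y)
    {m : ℝ} (hm : ∀ e, y e ≤ m) (e : E) (k : ℕ) :
    ρ ^ k * y e ≤ m * (H.nbTails e k).ncard := by
  classical
  induction k generalizing e with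
  | zero => simpa [nbTails_zero] using hm e
  | succ k ih =>
    rw [ncard_nbTails_succ, Nat.cast_sum, Finset.mul_sum, pow_succ, mul_assoc, ← hy.sum_eq e,
      Finset.mul_sum]
    exact Finset.sum_le_sum fun f _ => ih f

/-- The number of non-backtracking walks of length `k` from any vertex has the order of `ρ ^ k`. -/
theorem IsGrowthWeight.exists_bounds {ρ : ℝ} {y : E → ℝ} (hy : H.IsGrowthWeight ρ y) (hρ : 1 < ρ)
    (hmin : ∀ a, 2 ≤ H.degree a) :
    ∃ c₁ c₂ : ℝ, 0 < c₁ ∧ 0 < c₂ ∧ ∀ a k, c₁ * ρ ^ k ≤ (H.nbWalks a k).ncard ∧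
      ((H.nbWalks a k).ncard : ℝ) ≤ c₂ * ρ ^ k := by
  classical
  have hρ0 : 0 < ρ := by linarith
  cases isEmpty_or_nonempty V with
  | inl hV => exact ⟨1, 1, one_pos, one_pos, fun a => (hV.false a).elim⟩
  | inr hV =>
  have hout : ∀ a, ∃ e, H.tail e = a := by
    intro a
    have ha := hmin a
    obtain ⟨e, he⟩ := Set.nonempty_of_ncard_ne_zero (s := H.tail ⁻¹' {a})
      (by unfold degree at ha; omega)
    exact ⟨e, he⟩
  have hEne : Nonempty E := ⟨(hout hV.some).choose⟩
  obtain ⟨e₁, he₁⟩ := Finite.exists_min y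
  obtain ⟨e₂, he₂⟩ := Finite.exists_max y
  have h1 := hy.pos e₁
  have h2 := hy.pos e₂
  have hE : (1 : ℝ) ≤ Fintype.card E := by exact_mod_cast Fintype.card_pos
  have h12 : 1 ≤ y e₂ / y e₁ := (one_le_div h1).2 (he₁ e₂)
  refine ⟨y e₁ / y e₂ / ρ, Fintype.card E * (y e₂ / y e₁), by positivity, by positivity,
    fun a k => ?_⟩
  cases k with
  | zero =>
    simp only [nbWalks_zero, Set.ncard_singleton, pow_zero, mul_one, Nat.cast_one]
    refine ⟨?_, one_le_mul_of_one_le_of_one_le hE h12⟩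
    rw [div_le_one hρ0]
    exact ((div_le_one h2).2 (he₁ e₂)).trans hρ.le
  | succ k =>
    have hlow : ∀ f, y e₁ / y e₂ * ρ ^ k ≤ (H.nbTails f k).ncard := by
      intro f
      rw [div_mul_eq_mul_div, div_le_iff₀ h2]
      calc y e₁ * ρ ^ k ≤ ρ ^ k * y f := by
            rw [mul_comm]; exact mul_le_mul_of_nonneg_left (he₁ f) (by positivity)
        _ ≤ _ := (hy.le_mul_ncard_nbTails he₂ f k).trans_eq (mul_comm _ _)
    have hupp : ∀ f, ((H.nbTails f k).ncard : ℝ) ≤ y e₂ / y e₁ * ρ ^ k := by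
      intro f
      rw [div_mul_eq_mul_div, le_div_iff₀ h1]
      calc (H.nbTails f k).ncard * y e₁ ≤ ρ ^ k * y f :=
            (mul_comm _ _).trans_le (hy.mul_ncard_nbTails_le he₁ f k)
        _ ≤ _ := by rw [mul_comm]; exact mul_le_mul_of_nonneg_right (he₂ f) (by positivity)
    rw [ncard_nbWalks_succ, Nat.cast_sum]
    constructor
    · obtain ⟨e, he⟩ := hout a
      calc y e₁ / y e₂ / ρ * ρ ^ (k + 1) = y e₁ / y e₂ * ρ ^ k := by
            rw [pow_succ]; field_simp
        _ ≤ (H.nbTails e k).ncard := hlow e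
        _ ≤ _ := Finset.single_le_sum (f := fun f => ((H.nbTails f k).ncard : ℝ))
            (fun f _ => Nat.cast_nonneg _) (by simpa using he)
    · calc ∑ f with H.tail f = a, ((H.nbTails f k).ncard : ℝ)
          ≤ ∑ f : E, ((H.nbTails f k).ncard : ℝ) :=
            Finset.sum_le_sum_of_subset_of_nonneg (Finset.filter_subset _ _)
              fun f _ _ => Nat.cast_nonneg _
        _ ≤ ∑ f : E, y e₂ / y e₁ * ρ ^ k := Finset.sum_le_sum fun f _ => hupp f
        _ = Fintype.card E * (y e₂ / y e₁) * ρ ^ k := by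
            rw [Finset.sum_const, Finset.card_univ, nsmul_eq_mul, mul_assoc]
        _ ≤ _ := mul_le_mul_of_nonneg_left (pow_le_pow_right₀ hρ.le k.le_succ) (by positivity)

omit [Fintype E] in
/-- The bound `O(ρ ^ k)` for walks of length `k` carries over to walks of length at most `r`, since a
geometric series is dominated by its last term. -/
theorem exists_ncard_nbWalksLE_le [Finite E] {ρ c : ℝ} (hρ : 1 < ρ) (hc : 0 < c)
    (h : ∀ a k, ((H.nbWalks a k).ncard : ℝ) ≤ c * ρ ^ k) :
    ∃ C : ℝ, 0 < C ∧ ∀ a r, ((H.nbWalksLE a r).ncard : ℝ) ≤ C * ρ ^ r := by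
  have hρ0 : 0 < ρ := by linarith
  have hρ1 : 0 < ρ - 1 := sub_pos.2 hρ
  refine ⟨c * (ρ / (ρ - 1)), by positivity, fun a r => ?_⟩
  calc ((H.nbWalksLE a r).ncard : ℝ)
      ≤ ∑ k ∈ Finset.range (r + 1), ((H.nbWalks a k).ncard : ℝ) := by
        exact_mod_cast H.ncard_nbWalksLE_le a r
    _ ≤ ∑ k ∈ Finset.range (r + 1), c * ρ ^ k := Finset.sum_le_sum fun k _ => h a k
    _ = c * ((ρ ^ (r + 1) - 1) / (ρ - 1)) := by rw [← Finset.mul_sum, geom_sum_eq hρ.ne']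
    _ ≤ c * (ρ ^ (r + 1) / (ρ - 1)) := by gcongr; linarith
    _ = c * (ρ / (ρ - 1)) * ρ ^ r := by rw [pow_succ]; ring

end Counting

/-! ### Growth of the universal cover -/

section Growth

variable {H : MultiGraph V E} {a₀ : V}

/-- The vertex `p` of the universal cover, as a walk of `H`. -/
def UniversalCoverVertex.walk (p : H.UniversalCoverVertex a₀) : List E := p.1

theorem UniversalCoverVertex.walk_injective :
    Function.Injective (walk : H.UniversalCoverVertex a₀ → List E) :=
  fun _ _ h => Subtype.ext h

theorem length_le_of_isWalk_universalCover {p q : H.UniversalCoverVertex a₀}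
    {l : List (H.UniversalCoverEdge a₀)} (hl : (H.universalCover a₀).IsWalk p q l) :
    q.walk.length ≤ p.walk.length + l.length := by
  induction l generalizing p with
  | nil => cases hl; simp
  | cons e l ih =>
    obtain ⟨rfl, hl⟩ := hl
    have h1 := ih hl
    have h2 : ((H.universalCover a₀).head e).walk.length ≤
        ((H.universalCover a₀).tail e).walk.length + 1 := by
      change e.1.2.1.length ≤ e.1.1.1.length + 1
      rcases e.2 with ⟨f, hf⟩ | ⟨f, hf⟩
      · rw [hf, List.length_append, List.length_singleton]
      · rw [hf, List.length_append]
        omega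
    rw [List.length_cons]
    omega

/-- The empty walk, as a vertex of the universal cover. -/
def universalCoverRoot (H : MultiGraph V E) (a₀ : V) : H.UniversalCoverVertex a₀ :=
  ⟨[], ⟨a₀, rfl⟩, List.IsChain.nil⟩

theorem exists_isWalk_from_root (q : H.UniversalCoverVertex a₀) :
    ∃ l, (H.universalCover a₀).IsWalk (H.universalCoverRoot a₀) q l ∧ l.length = q.walk.length := by
  obtain ⟨p, hp⟩ := q
  induction p using List.reverseRecOn with
  | nil => exact ⟨[], rfl, rfl⟩
  | append_singleton p e ih =>
    obtain ⟨b, hb⟩ := hp.1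
    obtain ⟨c, hc, -⟩ := H.isWalk_append.1 hb
    have hp' : (∃ b, H.IsWalk a₀ b p) ∧ H.NonBacktracking p := ⟨⟨c, hc⟩, hp.2.left_of_append⟩
    obtain ⟨l, hl, hlen⟩ := ih hp'
    let f : H.UniversalCoverEdge a₀ := ⟨(⟨p, hp'⟩, ⟨p ++ [e], hp⟩), Or.inl ⟨e, rfl⟩⟩
    refine ⟨l ++ [f], hl.append ((H.universalCover a₀).isWalk_singleton f), ?_⟩
    rw [List.length_append, hlen]
    exact (List.length_append (as := p) (bs := [e])).symm

theorem ball_universalCover_subset (p : H.UniversalCoverVertex a₀) (r : ℕ) :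
    UniversalCoverVertex.walk '' (H.universalCover a₀).ball p r ⊆
      H.nbWalksLE a₀ (p.walk.length + r) := by
  rintro _ ⟨q, hq, rfl⟩
  refine ⟨q.2.1, q.2.2, ?_⟩
  have hlt : (H.universalCover a₀).dist p q < (r + 1 : ℕ) :=
    lt_of_le_of_lt hq (by exact_mod_cast Nat.lt_succ_self r)
  unfold dist at hlt
  simp only [iInf_lt_iff] at hlt
  obtain ⟨l, hl, hlen⟩ := hlt
  have := length_le_of_isWalk_universalCover hl
  have hlen' : l.length < r + 1 := by exact_mod_cast hlen
  change q.walk.length ≤ _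
  omega

theorem subset_ball_universalCover (p : H.UniversalCoverVertex a₀) {k r : ℕ}
    (hkr : p.walk.length + k ≤ r) :
    H.nbWalks a₀ k ⊆ UniversalCoverVertex.walk '' (H.universalCover a₀).ball p r := by
  rintro q ⟨hq, hnb, hk⟩
  refine ⟨⟨q, hq, hnb⟩, ?_, rfl⟩
  obtain ⟨l₁, h₁, hlen₁⟩ := exists_isWalk_from_root p
  obtain ⟨l₂, h₂, hlen₂⟩ := exists_isWalk_from_root (⟨q, hq, hnb⟩ : H.UniversalCoverVertex a₀)
  have hlen : ((H.universalCover a₀).reverse l₁ ++ l₂).length ≤ r := by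
    rw [List.length_append, length_reverse, hlen₁, hlen₂]
    exact hk ▸ hkr
  exact iInf₂_le_of_le (α := ℕ∞) _ (h₁.reverse.append h₂) (Nat.cast_le.2 hlen)

theorem ncard_ball_universalCover_le [Finite E] (p : H.UniversalCoverVertex a₀) (r : ℕ) :
    ((H.universalCover a₀).ball p r).ncard ≤ (H.nbWalksLE a₀ (p.walk.length + r)).ncard := by
  rw [← Set.ncard_image_of_injective _ UniversalCoverVertex.walk_injective]
  exact Set.ncard_le_ncard (ball_universalCover_subset p r) (H.finite_nbWalksLE _ _)

theorem le_ncard_ball_universalCover [Finite E] (p : H.UniversalCoverVertex a₀) {k r : ℕ}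
    (hkr : p.walk.length + k ≤ r) :
    (H.nbWalks a₀ k).ncard ≤ ((H.universalCover a₀).ball p r).ncard := by
  rw [← Set.ncard_image_of_injective ((H.universalCover a₀).ball p r) UniversalCoverVertex.walk_injective]
  exact Set.ncard_le_ncard (subset_ball_universalCover p hkr)
    ((H.finite_nbWalksLE _ _).subset (ball_universalCover_subset p r))

theorem tendsto_const_mul_pow_rpow_one_div {c ρ : ℝ} (hc : 0 < c) (hρ : 0 ≤ ρ) :
    Tendsto (fun r : ℕ => (c * ρ ^ r) ^ (1 / (r : ℝ))) atTop (𝓝 ρ) := by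
  have h : Tendsto (fun r : ℕ => c ^ (1 / (r : ℝ)) * ρ) atTop (𝓝 ρ) := by
    have := (tendsto_const_nhds (x := c)).rpow tendsto_one_div_atTop_nhds_zero_nat
      (Or.inl hc.ne')
    simpa using this.mul_const ρ
  refine h.congr' ?_
  filter_upwards [eventually_ne_atTop 0] with r hr
  rw [Real.mul_rpow hc.le (pow_nonneg hρ r), one_div, Real.pow_rpow_inv_natCast hρ hr]

theorem isGrowthRate_of_bounds [Finite E] {ρ c C : ℝ} (hρ : 1 < ρ) (hc : 0 < c) (hC : 0 < C)
    (hlow : ∀ a k, c * ρ ^ k ≤ (H.nbWalks a k).ncard)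
    (hupp : ∀ a r, ((H.nbWalksLE a r).ncard : ℝ) ≤ C * ρ ^ r) : H.IsGrowthRate ρ := by
  intro a₀ p
  have hρ0 : 0 < ρ := by linarith
  refine tendsto_of_tendsto_of_tendsto_of_le_of_le'
    (tendsto_const_mul_pow_rpow_one_div (c := c / ρ ^ p.walk.length) (by positivity) hρ0.le)
    (tendsto_const_mul_pow_rpow_one_div (c := C * ρ ^ p.walk.length) (by positivity) hρ0.le) ?_ ?_
  · filter_upwards [eventually_ge_atTop p.walk.length] with r hr
    refine Real.rpow_le_rpow (by positivity) ?_ (by positivity)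
    obtain ⟨k, rfl⟩ := Nat.exists_eq_add_of_le hr
    calc c / ρ ^ p.walk.length * ρ ^ (p.walk.length + k) = c * ρ ^ k := by rw [pow_add]; field_simp
      _ ≤ (H.nbWalks a₀ k).ncard := hlow a₀ k
      _ ≤ _ := by exact_mod_cast le_ncard_ball_universalCover p le_rfl
  · refine Eventually.of_forall fun r => ?_
    refine Real.rpow_le_rpow (by positivity) ?_ (by positivity)
    calc (((H.universalCover a₀).ball p r).ncard : ℝ)
        ≤ (H.nbWalksLE a₀ (p.walk.length + r)).ncard := by
          exact_mod_cast ncard_ball_universalCover_le p r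
      _ ≤ C * ρ ^ (p.walk.length + r) := hupp a₀ _
      _ = C * ρ ^ p.walk.length * ρ ^ r := by rw [pow_add, mul_assoc]

end Growth

/-! ### Closed non-backtracking walks and the girth -/

theorem isWalk_cons_append_cons {G : MultiGraph V E} {a c : V} {e f : E} {p q : List E}
    (h : G.IsWalk a c (e :: (p ++ f :: q))) : G.IsWalk (G.tail e) (G.tail f) (e :: p) := by
  obtain ⟨-, h⟩ := h
  obtain ⟨b, hb, hf, -⟩ := G.isWalk_append.1 h
  exact ⟨rfl, hf ▸ hb⟩

theorem exists_append_of_not_nodup_map {f : E → V} {l : List E} (h : ¬ (l.map f).Nodup) :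
    ∃ l₁ e l₂ e' l₃, l = l₁ ++ e :: (l₂ ++ e' :: l₃) ∧ f e = f e' := by
  induction l with
  | nil => simp at h
  | cons x l ih =>
    rw [List.map_cons, List.nodup_cons, not_and_or, not_not] at h
    rcases h with h | h
    · obtain ⟨y, hy, hxy⟩ := List.mem_map.1 h
      obtain ⟨l₂, l₃, rfl⟩ := List.append_of_mem hy
      exact ⟨[], x, l₂, y, l₃, rfl, hxy.symm⟩
    · obtain ⟨l₁, e, l₂, e', l₃, rfl, he⟩ := ih h
      exact ⟨x :: l₁, e, l₂, e', l₃, rfl, he⟩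

/-- A closed non-backtracking walk contains a cycle, namely a shortest closed subwalk. -/
theorem exists_isCycle {G : MultiGraph V E} {a : V} {p : List E} (hp : p ≠ [])
    (hw : G.IsWalk a a p) (hnb : G.NonBacktracking p) :
    ∃ c, G.IsCycle c ∧ c.length ≤ p.length := by
  induction hn : p.length using Nat.strong_induction_on generalizing p a with
  | _ n ih =>
    by_cases hnd : (p.map G.tail).Nodup
    · exact ⟨p, ⟨hp, ⟨a, hw⟩, hnb, hnd⟩, hn.le⟩
    · obtain ⟨l₁, e, l₂, f, l₃, rfl, hef⟩ := exists_append_of_not_nodup_map hnd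
      obtain ⟨b, -, hw'⟩ := G.isWalk_append.1 hw
      have hclosed := isWalk_cons_append_cons hw'
      rw [← hef] at hclosed
      have hnb' : G.NonBacktracking (e :: l₂) :=
        List.IsChain.infix hnb ⟨l₁, f :: l₃, by simp⟩
      have hlen : (e :: l₂).length < n := by
        rw [← hn]
        simp only [List.length_append, List.length_cons]
        omega
      obtain ⟨c, hc, hcl⟩ := ih _ hlen (List.cons_ne_nil _ _) hclosed hnb' rfl
      exact ⟨c, hc, hcl.trans hlen.le⟩

/-- All nonempty closed non-backtracking walks of `G` have length at least `g`. The last edge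
may be the inverse of the first one, and vertices may repeat; nevertheless, this says no more than that
the girth is at least `g` (`le_girth_iff`). -/
def ClosedWalksGE (G : MultiGraph V E) (g : ℕ) : Prop :=
  ∀ a p, p ≠ [] → G.IsWalk a a p → G.NonBacktracking p → g ≤ p.length

theorem le_girth_iff {G : MultiGraph V E} {g : ℕ} : (g : ℕ∞) ≤ G.girth ↔ G.ClosedWalksGE g := by
  constructor
  · intro h a p hp hw hnb
    obtain ⟨c, hc, hcl⟩ := exists_isCycle hp hw hnb
    have : (g : ℕ∞) ≤ c.length := h.trans (iInf₂_le c hc)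
    exact (Nat.cast_le.1 this).trans hcl
  · intro h
    refine le_iInf₂ fun p hp => ?_
    obtain ⟨a, ha⟩ := hp.2.1
    exact Nat.cast_le.2 (h a p hp.1 ha hp.2.2.1)

/-- Two different non-backtracking walks with the same ends produce a closed non-backtracking walk:
after the common final edges are removed, follow one and return along the other. -/
theorem ClosedWalksGE.le_length_add_length {G : MultiGraph V E} {g : ℕ} (hG : G.ClosedWalksGE g)
    {a b : V} {p q : List E} (hp : G.IsWalk a b p) (hpn : G.NonBacktracking p)
    (hq : G.IsWalk a b q) (hqn : G.NonBacktracking q) (hne : p ≠ q) :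
    g ≤ p.length + q.length := by
  induction p using List.reverseRecOn generalizing q b with
  | nil =>
    cases hp
    exact (hG a q hne.symm hq hqn).trans (Nat.le_add_left _ _)
  | append_singleton p e ih =>
    rcases List.eq_nil_or_concat' q with rfl | ⟨q, f, rfl⟩
    · cases hq
      exact (hG a _ (by simp) hp hpn).trans (Nat.le_add_right _ _)
    · obtain ⟨c, hc, hce, heb⟩ := G.isWalk_append.1 hp
      obtain ⟨c', hc', hce', heb'⟩ := G.isWalk_append.1 hq
      by_cases hef : e = f
      · subst hef
        have hcc : c' = c := hce'.symm.trans hce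
        subst hcc
        have := ih hc hpn.left_of_append hc' hqn.left_of_append (fun h => hne (by rw [h]))
        simp only [List.length_append, List.length_singleton]
        omega
      · have hclosed := hG a ((p ++ [e]) ++ G.reverse (q ++ [f])) (by simp) (hp.append hq.reverse) (by
          refine List.isChain_append.2 ⟨hpn, hqn.reverse, ?_⟩
          intro x hx y hy
          have hx' : x = e := by simpa using hx.symm
          have hy' : y = G.inv f := by simpa [reverse] using hy.symm
          subst hx' hy'
          exact fun h => hef (G.inv_injective h).symm)
        rwa [List.length_append, length_reverse] at hclosed

/-- The Moore bound: non-backtracking walks from `a` of length less than half the girth end at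
different vertices. -/
theorem ClosedWalksGE.ncard_nbWalks_le [Finite V] {G : MultiGraph V E} {g k : ℕ}
    (hG : G.ClosedWalksGE g) (hk : 2 * k < g) (a : V) : (G.nbWalks a k).ncard ≤ Nat.card V := by
  classical
  let t : List E → V := fun p => if h : ∃ b, G.IsWalk a b p then h.choose else a
  have ht : ∀ p ∈ G.nbWalks a k, G.IsWalk a (t p) p := fun p hp => by
    simp only [t, dif_pos hp.1]
    exact hp.1.choose_spec
  rw [← Set.ncard_univ]
  refine Set.ncard_le_ncard_of_injOn t (fun _ _ => Set.mem_univ _) ?_ Set.finite_univ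
  intro p hp q hq hpq
  by_contra hne
  have := hG.le_length_add_length (ht p hp) hp.2.1 (hpq ▸ ht q hq) hq.2.1 hne
  rw [hp.2.2, hq.2.2] at this
  omega

/-- Cancelling backtracking steps turns a walk into a non-backtracking one. -/
theorem IsWalk.exists_nonBacktracking {G : MultiGraph V E} {a b : V} {p : List E}
    (hp : G.IsWalk a b p) : ∃ q, G.IsWalk a b q ∧ G.NonBacktracking q ∧ q.length ≤ p.length := by
  induction p generalizing a with
  | nil => exact ⟨[], hp, List.IsChain.nil, le_rfl⟩
  | cons e p ih =>
    obtain ⟨q, hq, hqn, hlen⟩ := ih hp.2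
    rw [List.length_cons]
    cases q with
    | nil => exact ⟨[e], ⟨hp.1, hq⟩, List.IsChain.singleton e, by simp⟩
    | cons f q =>
      rw [List.length_cons] at hlen
      by_cases hf : f = G.inv e
      · refine ⟨q, ?_, List.IsChain.tail hqn, by omega⟩
        have := hq.2
        rwa [hf, G.head_inv, hp.1] at this
      · exact ⟨e :: f :: q, ⟨hp.1, hq⟩, List.isChain_cons_cons.2 ⟨hf, hqn⟩, by simp; omega⟩

/-! ### Coverings and walks -/

section Covering

variable {G : MultiGraph W F} {H : MultiGraph V E} {φ : W → V} {ψ : F → E}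

theorem IsCovering.isWalk_map (h : G.IsCovering H φ ψ) {a b : W} {p : List F}
    (hp : G.IsWalk a b p) : H.IsWalk (φ a) (φ b) (p.map ψ) := by
  induction p generalizing a with
  | nil => exact congrArg φ hp
  | cons e p ih => exact ⟨by rw [h.tail_map, hp.1], by rw [h.head_map]; exact ih hp.2⟩

theorem IsCovering.exists_isWalk (h : G.IsCovering H φ ψ) {a : W} {c : V} {q : List E}
    (hq : H.IsWalk (φ a) c q) : ∃ p b, G.IsWalk a b p ∧ p.map ψ = q := by
  induction q generalizing a with
  | nil => exact ⟨[], a, rfl, rfl⟩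
  | cons e q ih =>
    obtain ⟨f, hf, rfl⟩ := (h.bijOn a).surjOn hq.1
    have hq' := hq.2
    rw [h.head_map] at hq'
    obtain ⟨p, b, hp, rfl⟩ := ih hq'
    exact ⟨f :: p, b, ⟨hf, hp⟩, rfl⟩

theorem IsCovering.eq_of_map_eq (h : G.IsCovering H φ ψ) {a b c : W} {p q : List F}
    (hp : G.IsWalk a b p) (hq : G.IsWalk a c q) (hpq : p.map ψ = q.map ψ) : p = q := by
  induction p generalizing a q with
  | nil => exact (List.map_eq_nil_iff.1 hpq.symm).symm
  | cons e p ih =>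
    cases q with
    | nil => simp at hpq
    | cons f q =>
      rw [List.map_cons, List.map_cons, List.cons.injEq] at hpq
      obtain rfl := (h.bijOn a).injOn hp.1 hq.1 hpq.1
      rw [ih hp.2 hq.2 hpq.2]

theorem IsCovering.nonBacktracking_of_map (h : G.IsCovering H φ ψ) {p : List F}
    (hp : H.NonBacktracking (p.map ψ)) : G.NonBacktracking p := by
  refine ((List.isChain_map ψ).1 hp).imp fun e f hef hfe => hef ?_
  rw [hfe, h.inv_map]

theorem IsCovering.nonBacktracking_map (h : G.IsCovering H φ ψ) {a b : W} {p : List F}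
    (hw : G.IsWalk a b p) (hp : G.NonBacktracking p) : H.NonBacktracking (p.map ψ) := by
  induction p generalizing a with
  | nil => exact List.IsChain.nil
  | cons e p ih =>
    have hp' := ih hw.2 (List.IsChain.tail hp)
    cases p with
    | nil => exact List.IsChain.singleton _
    | cons f p =>
      refine List.isChain_cons_cons.2 ⟨?_, hp'⟩
      rw [← h.inv_map]
      exact fun hfe => (List.isChain_cons_cons.1 hp).1
        ((h.bijOn (G.head e)).injOn hw.2.1 (G.tail_inv e) hfe)

theorem IsCovering.le_ncard_nbWalks [Finite F] (h : G.IsCovering H φ ψ) (a : W) (k : ℕ) :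
    (H.nbWalks (φ a) k).ncard ≤ (G.nbWalks a k).ncard := by
  have hsub : H.nbWalks (φ a) k ⊆ List.map ψ '' G.nbWalks a k := by
    rintro q ⟨⟨c, hc⟩, hnb, hlen⟩
    obtain ⟨p, b, hp, rfl⟩ := h.exists_isWalk hc
    exact ⟨p, ⟨⟨b, hp⟩, h.nonBacktracking_of_map hnb, by simpa using hlen⟩, rfl⟩
  exact (Set.ncard_le_ncard hsub ((G.finite_nbWalks a k).image _)).trans
    (Set.ncard_image_le (G.finite_nbWalks a k))

theorem IsCovering.ncard_nbWalksLE_le [Finite E] (h : G.IsCovering H φ ψ) (a : W) (r : ℕ) :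
    (G.nbWalksLE a r).ncard ≤ (H.nbWalksLE (φ a) r).ncard := by
  refine Set.ncard_le_ncard_of_injOn (List.map ψ) ?_ ?_ (H.finite_nbWalksLE _ _)
  · rintro p ⟨⟨b, hp⟩, hnb, hlen⟩
    exact ⟨⟨_, h.isWalk_map hp⟩, h.nonBacktracking_map hp hnb, by simpa using hlen⟩
  · rintro p ⟨⟨b, hp⟩, -, -⟩ q ⟨⟨c, hq⟩, -, -⟩ hpq
    exact h.eq_of_map_eq hp hq hpq

end Covering

/-! ### Switching two edges -/

theorem isWalk_of_eq_on_walk {G G' : MultiGraph W F} {a b : W} {p : List F}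
    (htail : ∀ e, G'.tail e = G.tail e) (hinv : ∀ e ∈ p, G'.inv e = G.inv e)
    (hp : G'.IsWalk a b p) : G.IsWalk a b p := by
  induction p generalizing a with
  | nil => exact hp
  | cons e p ih =>
    refine ⟨(htail e).symm.trans hp.1, ?_⟩
    rw [← G.tail_inv, ← hinv e (by simp), ← htail, G'.tail_inv]
    exact ih (fun f hf => hinv f (by simp [hf])) hp.2

theorem nonBacktracking_of_eq_on_walk {G G' : MultiGraph W F} {p : List F}
    (hinv : ∀ e ∈ p, G'.inv e = G.inv e) (hp : G'.NonBacktracking p) : G.NonBacktracking p := by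
  induction p with
  | nil => exact List.IsChain.nil
  | cons e p ih =>
    have ih' := ih (fun f hf => hinv f (by simp [hf])) (List.IsChain.tail hp)
    cases p with
    | nil => exact List.IsChain.singleton e
    | cons f p =>
      have := List.isChain_cons_cons.1 hp
      exact List.isChain_cons_cons.2 ⟨hinv e (by simp) ▸ this.1, ih'⟩

theorem exists_first_of_mem {D : Set F} {p : List F} (h : ∃ e ∈ p, e ∈ D) :
    ∃ p₁ e p₂, p = p₁ ++ e :: p₂ ∧ e ∈ D ∧ ∀ f ∈ p₁, f ∉ D := by
  induction p with
  | nil => simp at h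
  | cons x p ih =>
    by_cases hx : x ∈ D
    · exact ⟨[], x, p, rfl, hx, by simp⟩
    · obtain ⟨y, hy, hyD⟩ := h
      have hyp : y ∈ p := (List.mem_cons.1 hy).resolve_left (fun h => hx (h ▸ hyD))
      obtain ⟨p₁, e, p₂, rfl, he, hp₁⟩ := ih ⟨y, hyp, hyD⟩
      refine ⟨x :: p₁, e, p₂, rfl, he, fun f hf => ?_⟩
      rcases List.mem_cons.1 hf with rfl | hf
      · exact hx
      · exact hp₁ f hf

/-- Suppose that `G'` arises from `G` by changing the inversion (and hence the heads) on the set `D`: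
an edge `e` of `D` now ends where another edge `f` of `D`, at a large distance from `e`, used to end.
Then short closed non-backtracking walks of `G'` avoid `D`. Indeed, the part of such a walk between
two consecutive edges of `D` would close up in `G`, possibly after adding one edge of `D`, and so
would be too long; and if there is only one edge of `D`, the rest of the walk would join edges that
are far apart. -/
theorem ClosedWalksGE.notMem_of_changed {G G' : MultiGraph W F} {γ : ℕ} {D : Set F}
    (hG : G.ClosedWalksGE γ) (htail : ∀ e, G'.tail e = G.tail e)
    (hinv : ∀ e ∉ D, G'.inv e = G.inv e) (hD : ∀ e ∈ D, G.inv e ∈ D)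
    (hpartner : ∀ e ∈ D, ∃ f ∈ D, G'.inv e = G.inv f ∧ e ≠ f ∧ e ≠ G.inv f)
    (hfar : ∀ e ∈ D, ∀ f ∈ D, ∀ p, G.IsWalk (G.tail e) (G.tail f) p → p.length ≤ γ →
      f = e ∨ f = G.inv e)
    {a : W} {q : List F} (hq : G'.IsWalk a a q) (hqn : G'.NonBacktracking q)
    (hlen : q.length ≤ γ) : ∀ e ∈ q, e ∉ D := by
  by_contra! hex
  obtain ⟨q₀, e, r, rfl, he, hq₀⟩ := exists_first_of_mem hex
  obtain ⟨f, hf, hef, hne, hne'⟩ := hpartner e he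
  have hhead : G'.head e = G.head f := by rw [← G'.tail_inv, htail, hef, G.tail_inv]
  obtain ⟨b, hb, heb, hr⟩ := G'.isWalk_append.1 hq
  rw [hhead] at hr
  rw [htail] at heb
  subst heb
  rw [List.length_append, List.length_cons] at hlen
  have hq₀' : ∀ e ∈ q₀, G'.inv e = G.inv e := fun e he => hinv e (hq₀ e he)
  have hrn : G'.NonBacktracking (e :: r) := hqn.right_of_append
  by_cases hex' : ∃ e ∈ r, e ∈ D
  · obtain ⟨s, e', t, rfl, he', hs⟩ := exists_first_of_mem hex'
    have hs' : ∀ e ∈ s, G'.inv e = G.inv e := fun e he => hinv e (hs e he)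
    obtain ⟨c, hc, hce, -⟩ := G'.isWalk_append.1 hr
    rw [htail] at hce
    subst hce
    have hsw : G.IsWalk (G.head f) (G.tail e') s := isWalk_of_eq_on_walk htail hs' hc
    have hsn : G.NonBacktracking s :=
      nonBacktracking_of_eq_on_walk hs' (List.IsChain.left_of_append (List.IsChain.tail hrn))
    rw [List.length_append, List.length_cons] at hlen
    have hsw' := hsw
    rw [← G.tail_inv] at hsw'
    rcases hfar _ (hD f hf) e' he' s hsw' (by omega) with rfl | rfl
    · -- The walk leaves `D` along `e` and comes back along the inverse of `e`.
      rw [G.tail_inv] at hsw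
      have hsne : s ≠ [] := by
        rintro rfl
        exact (List.isChain_cons_cons.1 hrn).1 hef.symm
      have := hG _ s hsne hsw hsn
      omega
    · -- The walk comes back to the tail of `f`, and `f` closes it up in `G`.
      rw [G.inv_inv] at hsw
      have hfs : G.NonBacktracking (f :: s) := by
        cases s with
        | nil => exact List.IsChain.singleton f
        | cons x s =>
          refine List.isChain_cons_cons.2 ⟨?_, hsn⟩
          rintro rfl
          exact hs _ (by simp) (hD f hf)
      have := hG _ (f :: s) (by simp) ⟨rfl, hsw⟩ hfs
      rw [List.length_cons] at this
      omega
  · push Not at hex'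
    have h₁ := isWalk_of_eq_on_walk htail (fun e he => hinv e (hex' e he)) hr
    have h₂ := isWalk_of_eq_on_walk htail hq₀' hb
    have h₃ := h₁.append h₂
    rw [← G.tail_inv] at h₃
    rcases hfar _ (hD f hf) e he _ h₃ (by rw [List.length_append]; omega) with h | h
    · exact hne' h
    · exact hne (h.trans (G.inv_inv f))

section Switch

variable [DecidableEq F]

/-- The graph obtained from `G` by switching the edges `d` and `d'`: if `d` goes from `x` to `y` and
`d'` goes from `z` to `w`, then in the new graph `d` goes from `x` to `w` and `d'` from `z` to `y`. The
tails are unchanged, and the involution is conjugated by the transposition of `d` and `d'`. -/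
def switch (G : MultiGraph W F) (d d' : F) : MultiGraph W F where
  tail := G.tail
  head e := G.tail (Equiv.swap d d' (G.inv (Equiv.swap d d' e)))
  inv e := Equiv.swap d d' (G.inv (Equiv.swap d d' e))
  inv_inv e := by simp [G.inv_inv]
  head_inv e := by simp [G.inv_inv]

theorem switch_inv (G : MultiGraph W F) (d d' e : F) :
    (G.switch d d').inv e = Equiv.swap d d' (G.inv (Equiv.swap d d' e)) := rfl

theorem switch_inv_ne {G : MultiGraph W F} (hG : ∀ e, G.inv e ≠ e) (d d' e : F) :
    (G.switch d d').inv e ≠ e := by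
  rw [switch_inv]
  intro h
  apply hG (Equiv.swap d d' e)
  rw [← Equiv.swap_apply_self d d' (G.inv (Equiv.swap d d' e)), h]

/-- Switching two edges above the same edge of `H` gives a lift of `H` again. -/
theorem IsCovering.switch {G : MultiGraph W F} {H : MultiGraph V E} {φ : W → V} {ψ : F → E}
    (h : G.IsCovering H φ ψ) {d d' : F} (hd : ψ d = ψ d') :
    (G.switch d d').IsCovering H φ ψ := by
  have hψ : ∀ e, ψ (Equiv.swap d d' e) = ψ e := by
    intro e
    by_cases h₁ : e = d
    · rw [h₁, Equiv.swap_apply_left, hd]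
    by_cases h₂ : e = d'
    · rw [h₂, Equiv.swap_apply_right, hd]
    rw [Equiv.swap_apply_of_ne_of_ne h₁ h₂]
  have hinv : ∀ e, ψ ((G.switch d d').inv e) = H.inv (ψ e) := fun e => by
    rw [switch_inv, hψ, h.inv_map, hψ]
  refine ⟨fun e => ?_, h.tail_map, hinv, h.surjective_vertex, h.surjective_edge, h.bijOn⟩
  rw [← H.tail_inv, ← hinv]
  exact h.tail_map _

/-- If there are no half-loops, and `d` and `d'` are far apart, a short closed non-backtracking walk
after the switch does not use the switched edges. -/
theorem ClosedWalksGE.notMem_of_switch {G : MultiGraph W F} {γ : ℕ} (hG : G.ClosedWalksGE γ)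
    (hloop : ∀ e, G.inv e ≠ e) {d d' : F}
    (hfar : ∀ p, G.IsWalk (G.tail d) (G.tail d') p → γ + 2 < p.length) {a : W} {q : List F}
    (hq : (G.switch d d').IsWalk a a q) (hqn : (G.switch d d').NonBacktracking q)
    (hlen : q.length ≤ γ) :
    (∀ e ∈ q, (G.switch d d').inv e = G.inv e) ∧ d ∉ q := by
  -- Walks between the two ends of `d` and the two ends of `d'` are long.
  have hnear : ∀ d e : F, e = d ∨ e = G.inv d →
      ∃ p, G.IsWalk (G.tail d) (G.tail e) p ∧ p.length ≤ 1 := by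
    rintro d _ (rfl | rfl)
    · exact ⟨[], rfl, by simp⟩
    · exact ⟨[d], by rw [G.tail_inv]; exact G.isWalk_singleton d, by simp⟩
  have hcross : ∀ e f, (e = d ∨ e = G.inv d) → (f = d' ∨ f = G.inv d') →
      ∀ p, G.IsWalk (G.tail e) (G.tail f) p → γ < p.length := by
    intro e f he hf p hp
    obtain ⟨p₁, h₁, hlen₁⟩ := hnear d e he
    obtain ⟨p₂, h₂, hlen₂⟩ := hnear d' f hf
    have := hfar _ ((h₁.append hp).append h₂.reverse)
    simp only [List.length_append, length_reverse] at this
    omega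
  have hcross' : ∀ e f, (e = d ∨ e = G.inv d) → (f = d' ∨ f = G.inv d') →
      ∀ p, G.IsWalk (G.tail f) (G.tail e) p → γ < p.length := by
    intro e f he hf p hp
    have := hcross e f he hf _ hp.reverse
    rwa [length_reverse] at this
  have hne : d' ≠ d := by
    rintro rfl
    exact absurd (hfar [] rfl) (by simp)
  have hne' : d' ≠ G.inv d := by
    rintro rfl
    exact absurd (hcross d _ (Or.inl rfl) (Or.inr rfl) [] (by rw [G.inv_inv]; rfl)) (by simp)
  have hne'' : G.inv d' ≠ d := fun h => hne' (G.inv_eq_iff.1 h)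
  have hneinv : G.inv d' ≠ G.inv d := fun h => hne (G.inv_injective h)
  set D : Set F := {e | (e = d ∨ e = G.inv d) ∨ (e = d' ∨ e = G.inv d')} with hDdef
  have hinv : ∀ e ∉ D, (G.switch d d').inv e = G.inv e := by
    intro e he
    simp only [hDdef, Set.mem_ofPred_eq, not_or] at he
    rw [switch_inv, Equiv.swap_apply_of_ne_of_ne he.1.1 he.2.1, Equiv.swap_apply_of_ne_of_ne]
    · exact fun h => he.1.2 (G.inv_eq_iff.1 h)
    · exact fun h => he.2.2 (G.inv_eq_iff.1 h)
  have hD : ∀ e ∈ D, G.inv e ∈ D := by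
    rintro e ((rfl | rfl) | (rfl | rfl))
    · exact Or.inl (Or.inr rfl)
    · exact Or.inl (Or.inl (G.inv_inv d))
    · exact Or.inr (Or.inr rfl)
    · exact Or.inr (Or.inl (G.inv_inv d'))
  have hpartner : ∀ e ∈ D, ∃ f ∈ D,
      (G.switch d d').inv e = G.inv f ∧ e ≠ f ∧ e ≠ G.inv f := by
    rintro e ((rfl | rfl) | (rfl | rfl))
    · refine ⟨d', Or.inr (Or.inl rfl), ?_, hne.symm, hne''.symm⟩
      rw [switch_inv, Equiv.swap_apply_left, Equiv.swap_apply_of_ne_of_ne hne'' (hloop d')]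
    · refine ⟨G.inv d', Or.inr (Or.inr rfl), ?_, hneinv.symm, ?_⟩
      · rw [switch_inv, Equiv.swap_apply_of_ne_of_ne (hloop d) hne'.symm, G.inv_inv, G.inv_inv,
          Equiv.swap_apply_left]
      · rw [G.inv_inv]
        exact hne'.symm
    · refine ⟨d, Or.inl (Or.inl rfl), ?_, hne, hne'⟩
      rw [switch_inv, Equiv.swap_apply_right, Equiv.swap_apply_of_ne_of_ne (hloop d) hne'.symm]
    · refine ⟨G.inv d, Or.inl (Or.inr rfl), ?_, hneinv, ?_⟩
      · rw [switch_inv, Equiv.swap_apply_of_ne_of_ne hne'' (hloop d'), G.inv_inv, G.inv_inv,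
          Equiv.swap_apply_right]
      · rw [G.inv_inv]
        exact hne''
  have hside : ∀ d e f : F, (e = d ∨ e = G.inv d) → (f = d ∨ f = G.inv d) →
      f = e ∨ f = G.inv e := by
    rintro d e f (rfl | rfl) (rfl | rfl)
    · exact Or.inl rfl
    · exact Or.inr rfl
    · exact Or.inr (G.inv_inv _).symm
    · exact Or.inl rfl
  have hmem := hG.notMem_of_changed (G' := G.switch d d') (fun _ => rfl) hinv hD hpartner (by
    rintro e (he | he) f (hf | hf) p hp hlen
    · exact hside d e f he hf
    · exact absurd hlen (not_le.2 (hcross e f he hf p hp))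
    · exact absurd hlen (not_le.2 (hcross' f e hf he p hp))
    · exact hside d' e f he hf) hq hqn hlen
  exact ⟨fun e he => hinv e (hmem e he), fun h => hmem d h (Or.inl (Or.inl rfl))⟩

end Switch

/-! ### Lifts of large girth -/

section LargeGirth

variable {X : Type} {H : MultiGraph V E}

/-- The trivial lift of `H` with fibre `X`, twisted by an involution of `X`. -/
def twistedLift (H : MultiGraph V E) {τ : X → X} (hτ : Function.Involutive τ) :
    MultiGraph (V × X) (E × X) where
  tail e := (H.tail e.1, e.2)
  head e := (H.head e.1, τ e.2)
  inv e := (H.inv e.1, τ e.2)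
  inv_inv e := by rw [H.inv_inv, hτ]
  head_inv e := by rw [H.head_inv, hτ]

/-- The lifts of `H` with fibre `X` and without half-loops: the tails are fixed, so only the
involution varies. -/
structure IsFibreLift (G : MultiGraph (V × X) (E × X)) (H : MultiGraph V E) : Prop where
  isCovering : G.IsCovering H Prod.fst Prod.fst
  tail_eq : ∀ e, G.tail e = (H.tail e.1, e.2)
  inv_ne : ∀ e, G.inv e ≠ e

theorem isFibreLift_twistedLift [Nonempty X] (H : MultiGraph V E) {τ : X → X}
    (hτ : Function.Involutive τ) (hτ' : ∀ x, τ x ≠ x) : (H.twistedLift hτ).IsFibreLift H where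
  isCovering :=
    { head_map := fun _ => rfl
      tail_map := fun _ => rfl
      inv_map := fun _ => rfl
      surjective_vertex := Prod.fst_surjective
      surjective_edge := Prod.fst_surjective
      bijOn := by
        rintro ⟨a, x⟩
        refine ⟨fun e he => congrArg Prod.fst he, ?_, fun e he => ⟨(e, x), ?_, rfl⟩⟩
        · rintro ⟨e, y⟩ he ⟨f, z⟩ hf (rfl : e = f)
          have hy : y = x := congrArg Prod.snd he
          have hz : z = x := congrArg Prod.snd hf
          rw [hy, hz]
        · exact congrArg (fun b => (b, x)) he }
  tail_eq _ := rfl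
  inv_ne e h := hτ' e.2 (congrArg Prod.snd h)

/-- The nonempty closed non-backtracking walks of length `γ`. -/
def closedWalks (G : MultiGraph W F) (γ : ℕ) : Set (List F) :=
  {p | p ≠ [] ∧ (∃ a, G.IsWalk a a p) ∧ G.NonBacktracking p ∧ p.length = γ}

theorem finite_closedWalks [Finite F] (G : MultiGraph W F) (γ : ℕ) : (G.closedWalks γ).Finite :=
  (List.finite_length_eq F γ).subset fun _ h => h.2.2.2

theorem ClosedWalksGE.succ {G : MultiGraph W F} {γ : ℕ} (hG : G.ClosedWalksGE γ)
    (h : G.closedWalks γ = ∅) : G.ClosedWalksGE (γ + 1) := by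
  intro a p hp hw hnb
  refine Nat.succ_le_of_lt (lt_of_le_of_ne (hG a p hp hw hnb) fun hlen => ?_)
  exact (Set.mem_empty_iff_false p).1 (h ▸ ⟨hp, ⟨a, hw⟩, hnb, hlen.symm⟩)

/-- A fibre with more elements than there are non-backtracking walks of length at most `r` contains
a vertex that cannot be reached from `a` in `r` steps. -/
theorem IsFibreLift.exists_far [Finite E] [Finite X] {G : MultiGraph (V × X) (E × X)}
    (hG : G.IsFibreLift H) (a : V × X) (b : V) {r : ℕ}
    (hX : (H.nbWalksLE a.1 r).ncard < Nat.card X) :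
    ∃ x, ∀ p, G.IsWalk a (b, x) p → r < p.length := by
  by_contra! h
  have h' : ∀ x, ∃ q, G.IsWalk a (b, x) q ∧ G.NonBacktracking q ∧ q.length ≤ r := by
    intro x
    obtain ⟨p, hp, hlen⟩ := h x
    obtain ⟨q, hq, hqn, hle⟩ := hp.exists_nonBacktracking
    exact ⟨q, hq, hqn, hle.trans hlen⟩
  choose q hq hqn hlen using h'
  have hinj : Function.Injective q := fun x y hxy =>
    congrArg Prod.snd ((hq x).end_unique (hxy ▸ hq y))
  have h₁ : Nat.card X ≤ (G.nbWalksLE a r).ncard := by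
    rw [← Set.ncard_univ]
    exact Set.ncard_le_ncard_of_injOn q (fun x _ => ⟨⟨_, hq x⟩, hqn x, hlen x⟩)
      hinj.injOn (G.finite_nbWalksLE a r)
  exact absurd hX (not_lt.2 (h₁.trans (hG.isCovering.ncard_nbWalksLE_le a r)))

/-- If the fibre is large enough, a switch removes a given shortest closed non-backtracking walk
without creating new ones of at most the same length. -/
theorem IsFibreLift.exists_switch [Finite E] [Finite X] {G : MultiGraph (V × X) (E × X)} {γ : ℕ}
    (hG : G.IsFibreLift H) (hγ : G.ClosedWalksGE γ)
    (hX : ∀ a, (H.nbWalksLE a (γ + 2)).ncard < Nat.card X) (hne : (G.closedWalks γ).Nonempty) :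
    ∃ G' : MultiGraph (V × X) (E × X), G'.IsFibreLift H ∧ G'.ClosedWalksGE γ ∧
      (G'.closedWalks γ).ncard < (G.closedWalks γ).ncard := by
  classical
  obtain ⟨p, hp⟩ := hne
  obtain ⟨d, p', rfl⟩ := List.exists_cons_of_ne_nil hp.1
  obtain ⟨x, hx⟩ := hG.exists_far (G.tail d) (H.tail d.1) (hX _)
  have htail : G.tail (d.1, x) = (H.tail d.1, x) := hG.tail_eq _
  rw [← htail] at hx
  have hkey : ∀ a q, (G.switch d (d.1, x)).IsWalk a a q →
      (G.switch d (d.1, x)).NonBacktracking q → q.length ≤ γ →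
      G.IsWalk a a q ∧ G.NonBacktracking q ∧ d ∉ q := by
    intro a q hq hqn hlen
    obtain ⟨hinv, hd⟩ := hγ.notMem_of_switch hG.inv_ne hx hq hqn hlen
    exact ⟨isWalk_of_eq_on_walk (G' := G.switch d (d.1, x)) (fun _ => rfl) hinv hq,
      nonBacktracking_of_eq_on_walk hinv hqn, hd⟩
  refine ⟨G.switch d (d.1, x), ⟨hG.isCovering.switch rfl, hG.tail_eq, switch_inv_ne hG.inv_ne d _⟩,
    ?_, ?_⟩
  · intro a q hq hw hqn
    by_contra! hlt
    obtain ⟨h₁, h₂, -⟩ := hkey a q hw hqn hlt.le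
    exact absurd (hγ a q hq h₁ h₂) (not_le.2 hlt)
  · refine Set.ncard_lt_ncard ⟨?_, fun hsub => ?_⟩ (G.finite_closedWalks γ)
    · rintro q ⟨hq, ⟨a, hw⟩, hqn, hlen⟩
      obtain ⟨h₁, h₂, -⟩ := hkey a q hw hqn hlen.le
      exact ⟨hq, ⟨a, h₁⟩, h₂, hlen⟩
    · obtain ⟨-, ⟨a, hw⟩, hqn, hlen⟩ := hsub hp
      exact (hkey a _ hw hqn hlen.le).2.2 (by simp)

theorem IsFibreLift.exists_closedWalksGE_succ [Finite E] [Finite X]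
    {G : MultiGraph (V × X) (E × X)} {γ : ℕ} (hG : G.IsFibreLift H) (hγ : G.ClosedWalksGE γ)
    (hX : ∀ a, (H.nbWalksLE a (γ + 2)).ncard < Nat.card X) :
    ∃ G' : MultiGraph (V × X) (E × X), G'.IsFibreLift H ∧ G'.ClosedWalksGE (γ + 1) := by
  induction hn : (G.closedWalks γ).ncard using Nat.strong_induction_on generalizing G with
  | _ n ih =>
    rcases (G.closedWalks γ).eq_empty_or_nonempty with h | h
    · exact ⟨G, hG, hγ.succ h⟩
    · obtain ⟨G', hG', hγ', hlt⟩ := hG.exists_switch hγ hX h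
      exact ih _ (hn ▸ hlt) hG' hγ' rfl

theorem nbWalksLE_mono (H : MultiGraph V E) (a : V) {r s : ℕ} (hrs : r ≤ s) :
    H.nbWalksLE a r ⊆ H.nbWalksLE a s :=
  fun _ hp => ⟨hp.1, hp.2.1, hp.2.2.trans hrs⟩

theorem exists_isFibreLift_closedWalksGE [Finite E] [Finite X] [Nonempty X] {τ : X → X}
    (hτ : Function.Involutive τ) (hτ' : ∀ x, τ x ≠ x) {g : ℕ}
    (hX : ∀ a, (H.nbWalksLE a (g + 2)).ncard < Nat.card X) :
    ∃ G : MultiGraph (V × X) (E × X), G.IsFibreLift H ∧ G.ClosedWalksGE g := by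
  suffices h : ∀ γ ≤ g, ∃ G : MultiGraph (V × X) (E × X), G.IsFibreLift H ∧ G.ClosedWalksGE γ from
    h g le_rfl
  intro γ
  induction γ with
  | zero => exact fun _ => ⟨_, H.isFibreLift_twistedLift hτ hτ', fun _ _ _ _ _ => Nat.zero_le _⟩
  | succ γ ih =>
    intro hle
    obtain ⟨G, hG, hγ⟩ := ih (by omega)
    refine hG.exists_closedWalksGE_succ hγ fun a => lt_of_le_of_lt ?_ (hX a)
    exact Set.ncard_le_ncard (H.nbWalksLE_mono a (by omega)) (H.finite_nbWalksLE _ _)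

/-- The Erdős–Sachs bound for lifts. The fibre `Bool × Fin m` carries a fixed-point-free involution,
which provides a first lift without half-loops. -/
theorem mem_liftSizes [Finite V] [Finite E] (H : MultiGraph V E) {g m : ℕ} (hm : 0 < m)
    (h : ∀ a, (H.nbWalksLE a (g + 2)).ncard ≤ m) : Nat.card V * (2 * m) ∈ H.liftSizes g := by
  have : Nonempty (Fin m) := ⟨⟨0, hm⟩⟩
  have hcard : Nat.card (Bool × Fin m) = 2 * m := by simp
  obtain ⟨G, hG, hg⟩ := exists_isFibreLift_closedWalksGE (H := H) (g := g) (X := Bool × Fin m)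
    (τ := fun x => (!x.1, x.2)) (fun x => by simp)
    (fun x hx => by simpa using congrArg Prod.fst hx)
    (fun a => by rw [hcard]; have := h a; omega)
  exact ⟨V × (Bool × Fin m), E × (Bool × Fin m), inferInstance, inferInstance, G,
    ⟨_, _, hG.isCovering⟩, le_girth_iff.2 hg, by rw [Nat.card_prod, hcard]⟩

end LargeGirth

theorem exists_minLiftSize_le [Finite V] [Finite E] {H : MultiGraph V E} {ρ C : ℝ} (hρ : 1 < ρ)
    (hC : 0 < C) (hupp : ∀ a r, ((H.nbWalksLE a r).ncard : ℝ) ≤ C * ρ ^ r) :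
    (∀ g, (H.liftSizes g).Nonempty) ∧
      ∃ c : ℝ, 0 < c ∧ ∀ g, (H.minLiftSize g : ℝ) ≤ c * ρ ^ g := by
  have hρ0 : 0 < ρ := by linarith
  have hmem : ∀ g, Nat.card V * (2 * ⌈C * ρ ^ (g + 2)⌉₊) ∈ H.liftSizes g := fun g =>
    H.mem_liftSizes (Nat.ceil_pos.2 (by positivity)) fun a => by
      exact_mod_cast (hupp a (g + 2)).trans (Nat.le_ceil _)
  refine ⟨fun g => ⟨_, hmem g⟩, (Nat.card V + 1) * (2 * (C * ρ ^ 2 + 1)), by positivity,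
    fun g => ?_⟩
  have hceil : (⌈C * ρ ^ (g + 2)⌉₊ : ℝ) ≤ (C * ρ ^ 2 + 1) * ρ ^ g := by
    have h₁ := (Nat.ceil_lt_add_one (by positivity : 0 ≤ C * ρ ^ (g + 2))).le
    have h₂ : 1 ≤ ρ ^ g := one_le_pow₀ hρ.le
    calc (⌈C * ρ ^ (g + 2)⌉₊ : ℝ) ≤ C * ρ ^ (g + 2) + 1 := h₁
      _ ≤ C * ρ ^ (g + 2) + ρ ^ g := by linarith
      _ = _ := by ring
  calc (H.minLiftSize g : ℝ) ≤ Nat.card V * (2 * ⌈C * ρ ^ (g + 2)⌉₊) := by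
        exact_mod_cast Nat.sInf_le (hmem g)
    _ ≤ (Nat.card V + 1) * (2 * ((C * ρ ^ 2 + 1) * ρ ^ g)) := by
        gcongr
        linarith
    _ = _ := by ring

/-- The Moore bound for lifts. -/
theorem exists_le_minLiftSize [Nonempty V] {H : MultiGraph V E} {ρ c : ℝ} (hρ : 1 < ρ)
    (hc : 0 < c) (hlow : ∀ a k, c * ρ ^ k ≤ (H.nbWalks a k).ncard)
    (hne : ∀ g, (H.liftSizes g).Nonempty) :
    ∃ c' : ℝ, 0 < c' ∧ ∀ g : ℕ, c' * ρ ^ ((g : ℝ) / 2) ≤ (H.minLiftSize g : ℝ) := by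
  have hρ0 : 0 < ρ := by linarith
  refine ⟨c / ρ, by positivity, fun g => ?_⟩
  obtain ⟨W, F, hW, hF, G, ⟨φ, ψ, hcov⟩, hg, hcard⟩ := Nat.sInf_mem (hne g)
  obtain ⟨a, -⟩ := hcov.surjective_vertex (Classical.arbitrary V)
  -- Walks of length `k` with `2 * k < g` have different ends; for `g = 0` there is no such `k`,
  -- but then a single vertex is enough.
  set k := (g - 1) / 2 with hk
  have hgk : (g : ℝ) / 2 ≤ k + 1 := by
    have : g ≤ 2 * (k + 1) := by omega
    have : (g : ℝ) ≤ 2 * (k + 1) := by exact_mod_cast this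
    linarith
  have hcount : (G.nbWalks a k).ncard ≤ Nat.card W := by
    rcases Nat.eq_zero_or_pos g with h0 | hpos
    · have hk0 : k = 0 := by omega
      have : Nonempty W := ⟨a⟩
      rw [hk0, nbWalks_zero, Set.ncard_singleton]
      exact Nat.card_pos
    · exact (le_girth_iff.1 hg).ncard_nbWalks_le (by omega) a
  calc c / ρ * ρ ^ ((g : ℝ) / 2) ≤ c / ρ * ρ ^ ((k : ℝ) + 1) := by
        gcongr
        exact hρ.le
    _ = c * ρ ^ k := by
        rw [Real.rpow_add hρ0, Real.rpow_natCast, Real.rpow_one]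
        field_simp
    _ ≤ (H.nbWalks (φ a) k).ncard := hlow _ _
    _ ≤ (Nat.card W : ℝ) := by exact_mod_cast (hcov.le_ncard_nbWalks a k).trans hcount
    _ = (H.minLiftSize g : ℝ) := by rw [hcard]; rfl

end MultiGraph

theorem theorem1 {V : Type u} {E : Type v} [Fintype V] [Fintype E] [DecidableEq E]
    (H : MultiGraph V E) (hconn : H.Connected)
    (hmin : ∀ a, 2 ≤ H.degree a) (hmax : ∃ a, 2 < H.degree a) :
    ∃ ρ : ℝ, H.IsGrowthRate ρ ∧ IsPerronEigenvalue H.nonBacktrackingMatrix ρ ∧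
      (∀ g : ℕ, (H.liftSizes g).Nonempty) ∧
      ∃ c₁ c₂ : ℝ, 0 < c₁ ∧ 0 < c₂ ∧
        ∀ g : ℕ, c₁ * ρ ^ ((g : ℝ) / 2) ≤ (H.minLiftSize g : ℝ) ∧
          (H.minLiftSize g : ℝ) ≤ c₂ * ρ ^ g := by
  obtain ⟨ρ, hperron, hρ, y, hy⟩ := MultiGraph.exists_isPerronEigenvalue hconn hmin hmax
  obtain ⟨c, C, hc, hC, hbounds⟩ := hy.exists_bounds hρ hmin
  obtain ⟨C', hC', hupp⟩ := MultiGraph.exists_ncard_nbWalksLE_le hρ hC fun a k => (hbounds a k).2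
  obtain ⟨hne, c₂, hc₂, h₂⟩ := MultiGraph.exists_minLiftSize_le hρ hC' hupp
  have : Nonempty V := hconn.1
  obtain ⟨c₁, hc₁, h₁⟩ :=
    MultiGraph.exists_le_minLiftSize hρ hc (fun a k => (hbounds a k).1) hne
  exact ⟨ρ, MultiGraph.isGrowthRate_of_bounds hρ hc hC' (fun a k => (hbounds a k).1) hupp, hperron,
    hne, c₁, c₂, hc₁, hc₂, fun g => ⟨h₁ g, h₂ g⟩⟩
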